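/- Let $\mathbf K$ be a commutative $\mathbb Q$-algebra, $N\ge 1$ an integer, $\mu_N\subset\mathbb C^\times$ the group of $N$-th roots of unity and $\zeta_N=e^{2\pi i/N}$. *Betti side.* Let $F_2$ be the free group on $X_0,X_1$, let $\mathcal I_N$ be the kernel of the algebra morphism $\mathbf KF_2\to\mathbf K\mu_N$ induced by $X_0\mapsto\zeta_N$, $X_1\mapsto1$, and let $\mathcal V^{B}_N=\mathbf KF_2$ be filtered by $\mathcal F^m\mathcal V^B_N=\mathbf KF_2$ for $m\le 0$ and $\mathcal F^m\mathcal V^B_N=\mathcal I_N^m$ for $m>0$. Let $\mathcal W^B_N=\mathbf K\oplus\mathbf KF_2(X_1-1)\subset\mathbf KF_2$, filtered by $\mathcal F^m\mathcal W^B_N=\mathcal W^B_N\cap\mathcal F^m\mathcal V^B_N$ ($m\in\mathbb Z$), and let $\mathcal F^m(\mathcal W^B_N\otimes\mathcal W^B_N)=\sum_{i+j=m}\operatorname{im}(\mathcal F^i\mathcal W^B_N\otimes\mathcal F^j\mathcal W^B_N)$. For a filtered algebra $A$ write $\operatorname{gr}(A)=\bigoplus_{m\in\mathbb Z}\mathcal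 F^mA/\mathcal F^{m+1}A$, and $[a]_m$ for the class of $a\in\mathcal F^mA$. Let $\Delta^{\mathcal W,B}:\mathcal W^B_N\to\mathcal W^B_N\otimes\mathcal W^B_N$ be the unique algebra morphism with $X_1^{-1}\mapsto X_1^{-1}\otimes X_1^{-1}$ and, for $n\in\mathbb Z$, $$X_0^n(X_1-1)\mapsto X_0^n(X_1-1)\otimes1+1\otimes X_0^n(X_1-1)-\sum_{k=1}^{n-1}X_0^k(X_1-1)\otimes X_0^{n-k}(X_1-1),$$ where $\sum_{k=p}^q f(k)$ means $0$ if $q=p-1$ and $-\sum_{k=q+1}^{p-1}f(k)$ if $q<p-1$. *De Rham side.* Let $\mathcal V^{DR}_N$ be the graded $\mathbf K$-algebra generated by $e_0,e_1$ (degree $1$) and the elements of $\mu_N$ (degree $0$), subject to the relations that the product of two elements of $\mu_N$ is their product in $\mu_N$, that $1\in\mu_N$ is the unit, and that $\zeta e_0=e_0\zeta$ for $\zeta\in\mu_N$. Let $\mathcal W^{DR}_N=\mathbf K\oplus\mathcal V^{DR}_Ne_1$, put $z_{n,\zeta}=-e_0^{n-1}\zeta e_1$ for $n\ge1$, $\zeta\in\mu_N$,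 and let $\Delta^{\mathcal W,DR}_N:\mathcal W^{DR}_N\to\mathcal W^{DR}_N\otimes\mathcal W^{DR}_N$ be the unique algebra morphism with $$z_{n,\zeta}\mapsto z_{n,\zeta}\otimes1+1\otimes z_{n,\zeta}+\sum_{k=1}^{n-1}\sum_{\eta\in\mu_N}z_{k,\eta}\otimes z_{n-k,\zeta\eta^{-1}}.$$ Let $\rho^{\mathcal W}_N:\mathcal W^{DR}_N\to\operatorname{gr}(\mathcal W^B_N)$ be the restriction of the algebra morphism $\rho^{\mathcal V}_N:\mathcal V^{DR}_N\to\operatorname{gr}(\mathcal V^B_N)$ given by $\zeta_N\mapsto[X_0]_0$, $e_0\mapsto[X_0^N-1]_1$, $e_1\mapsto[X_1-1]_1$. **Theorem.** The morphism $\rho^{\mathcal W}_N$ is an isomorphism of graded algebras. Moreover $\Delta^{\mathcal W,B}(\mathcal F^m\mathcal W^B_N)\subset\mathcal F^m(\mathcal W^B_N\otimes\mathcal W^B_N)$ for all $m\in\mathbb Z$, the canonical morphism $\operatorname{gr}(\mathcal W^B_N)\otimes\operatorname{gr}(\mathcal W^B_N)\to\operatorname{gr}(\mathcal W^B_N\otimes\mathcal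 W^B_N)$, $[a]_i\otimes[b]_j\mapsto[a\otimes b]_{i+j}$, is an isomorphism, and the resulting graded algebra morphism $\operatorname{gr}(\Delta^{\mathcal W,B}):\operatorname{gr}(\mathcal W^B_N)\to\operatorname{gr}(\mathcal W^B_N)\otimes\operatorname{gr}(\mathcal W^B_N)$ satisfies $$(\rho^{\mathcal W}_N\otimes\rho^{\mathcal W}_N)\circ\Delta^{\mathcal W,DR}_N=\operatorname{gr}(\Delta^{\mathcal W,B})\circ\rho^{\mathcal W}_N.$$ -/

import Mathlib

open scoped TensorProduct DirectSum

/-- A decreasing algebra filtration, indexed by `ℤ`, on a `K`-algebra `A`. -/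
structure AlgFiltration (K A : Type*) [CommRing K] [Ring A] [Algebra K A] where
  F : ℤ → Submodule K A
  anti : Antitone F
  one_mem : (1 : A) ∈ F 0
  mul_mem : ∀ {i j : ℤ} {a b : A}, a ∈ F i → b ∈ F j → a * b ∈ F (i + j)

namespace AlgFiltration

section Gr

variable {K A : Type*} [CommRing K] [Ring A] [Algebra K A] (𝓕 : AlgFiltration K A)

/-- The degree `i` piece `F^i / F^(i+1)` of the associated graded algebra. -/
def Piece (i : ℤ) : Type _ := (𝓕.F i) ⧸ (𝓕.F (i + 1)).submoduleOf (𝓕.F i)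

noncomputable instance (i : ℤ) : AddCommGroup (𝓕.Piece i) :=
  inferInstanceAs (AddCommGroup ((𝓕.F i) ⧸ (𝓕.F (i + 1)).submoduleOf (𝓕.F i)))

noncomputable instance (i : ℤ) : Module K (𝓕.Piece i) :=
  inferInstanceAs (Module K ((𝓕.F i) ⧸ (𝓕.F (i + 1)).submoduleOf (𝓕.F i)))

/-- The projection `F^i → F^i / F^(i+1)`. -/
noncomputable def proj (i : ℤ) : 𝓕.F i →ₗ[K] 𝓕.Piece i :=
  ((𝓕.F (i + 1)).submoduleOf (𝓕.F i)).mkQ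

theorem proj_surjective (i : ℤ) : Function.Surjective (𝓕.proj i) :=
  Submodule.mkQ_surjective _

theorem proj_eq_zero_iff {i : ℤ} (a : 𝓕.F i) : 𝓕.proj i a = 0 ↔ (a : A) ∈ 𝓕.F (i + 1) :=
  Submodule.Quotient.mk_eq_zero ((𝓕.F (i + 1)).submoduleOf (𝓕.F i))

/-- Multiplication of representatives. -/
noncomputable def mulRep (i j : ℤ) : 𝓕.F i →ₗ[K] 𝓕.F j →ₗ[K] 𝓕.Piece (i + j) :=
  LinearMap.mk₂ K (fun a b => 𝓕.proj (i + j) ⟨a * b, 𝓕.mul_mem a.2 b.2⟩)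
    (fun a a' b => by rw [← map_add]; congr 1; ext; simp [add_mul])
    (fun c a b => by rw [← map_smul]; congr 1; ext; simp)
    (fun a b b' => by rw [← map_add]; congr 1; ext; simp [mul_add])
    (fun c a b => by rw [← map_smul]; congr 1; ext; simp)

/-- The product `F^i/F^(i+1) × F^j/F^(j+1) → F^(i+j)/F^(i+j+1)`, `[a] [b] = [a b]`. -/
noncomputable def mulPiece (i j : ℤ) : 𝓕.Piece i →ₗ[K] 𝓕.Piece j →ₗ[K] 𝓕.Piece (i + j) :=
  Submodule.liftQ _ (LinearMap.flip (Submodule.liftQ _ (LinearMap.flip (𝓕.mulRep i j)) (by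
    intro b hb
    ext a
    have h := 𝓕.mul_mem a.2 (show (b : A) ∈ 𝓕.F (j + 1) from hb)
    rw [← add_assoc] at h
    exact (𝓕.proj_eq_zero_iff _).2 h))) (by
    intro a ha
    refine LinearMap.ext fun b => ?_
    obtain ⟨b, rfl⟩ := 𝓕.proj_surjective j b
    have h := 𝓕.mul_mem (show (a : A) ∈ 𝓕.F (i + 1) from ha) b.2
    rw [add_right_comm] at h
    exact (𝓕.proj_eq_zero_iff _).2 h)

theorem mulPiece_proj {i j : ℤ} (a : 𝓕.F i) (b : 𝓕.F j) :
    𝓕.mulPiece i j (𝓕.proj i a) (𝓕.proj j b) =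
      𝓕.proj (i + j) ⟨a * b, 𝓕.mul_mem a.2 b.2⟩ := rfl

theorem mk_proj_eq {i j : ℤ} (h : i = j) {a b : A} (hab : a = b) (ha : a ∈ 𝓕.F i)
    (hb : b ∈ 𝓕.F j) :
    (GradedMonoid.mk i (𝓕.proj i ⟨a, ha⟩) : GradedMonoid 𝓕.Piece) =
      GradedMonoid.mk j (𝓕.proj j ⟨b, hb⟩) := by
  subst h; subst hab; rfl

noncomputable instance : GradedMonoid.GMul 𝓕.Piece where
  mul {i j} a b := 𝓕.mulPiece i j a b

noncomputable instance : GradedMonoid.GOne 𝓕.Piece where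
  one := 𝓕.proj 0 ⟨1, 𝓕.one_mem⟩

noncomputable instance : DirectSum.GRing 𝓕.Piece where
  mul_zero a := map_zero (𝓕.mulPiece _ _ a)
  zero_mul b := LinearMap.map_zero₂ (𝓕.mulPiece _ _) b
  mul_add a b c := map_add (𝓕.mulPiece _ _ a) b c
  add_mul a b c := LinearMap.map_add₂ (𝓕.mulPiece _ _) a b c
  one_mul := by
    rintro ⟨i, a⟩
    obtain ⟨a, rfl⟩ := 𝓕.proj_surjective i a
    exact 𝓕.mk_proj_eq (zero_add i) (one_mul _) _ _
  mul_one := by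
    rintro ⟨i, a⟩
    obtain ⟨a, rfl⟩ := 𝓕.proj_surjective i a
    exact 𝓕.mk_proj_eq (add_zero i) (mul_one _) _ _
  mul_assoc := by
    rintro ⟨i, a⟩ ⟨j, b⟩ ⟨k, c⟩
    obtain ⟨a, rfl⟩ := 𝓕.proj_surjective i a
    obtain ⟨b, rfl⟩ := 𝓕.proj_surjective j b
    obtain ⟨c, rfl⟩ := 𝓕.proj_surjective k c
    exact 𝓕.mk_proj_eq (add_assoc i j k) (mul_assoc _ _ _) _ _
  natCast n := n • 𝓕.proj 0 ⟨1, 𝓕.one_mem⟩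
  natCast_zero := zero_smul _ _
  natCast_succ n := succ_nsmul _ _
  intCast n := n • 𝓕.proj 0 ⟨1, 𝓕.one_mem⟩
  intCast_ofNat n := natCast_zsmul _ _
  intCast_negSucc_ofNat n := negSucc_zsmul _ _

theorem smul_one_mem (c : K) : c • (1 : A) ∈ 𝓕.F 0 := Submodule.smul_mem _ _ 𝓕.one_mem

noncomputable instance : DirectSum.GAlgebra K 𝓕.Piece where
  toFun := AddMonoidHom.mk' (fun c => 𝓕.proj 0 ⟨c • (1 : A), 𝓕.smul_one_mem c⟩) (fun a b => by
    rw [← map_add]; congr 1; ext; simp [add_smul])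
  map_one := by
    change 𝓕.proj 0 _ = 𝓕.proj 0 _
    congr 1; ext; simp
  map_mul r s := 𝓕.mk_proj_eq (zero_add 0).symm (by rw [smul_mul_smul_comm, one_mul]) _ _
  commutes := by
    rintro r ⟨i, a⟩
    obtain ⟨a, rfl⟩ := 𝓕.proj_surjective i a
    exact 𝓕.mk_proj_eq ((zero_add i).trans (add_zero i).symm) (by simp) _ _
  smul_def := by
    rintro r ⟨i, a⟩
    obtain ⟨a, rfl⟩ := 𝓕.proj_surjective i a
    exact 𝓕.mk_proj_eq (zero_add i).symm (by simp) (Submodule.smul_mem _ r a.2) _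

/-- The associated graded algebra `gr(A) = ⨁ i, F^i / F^(i+1)`. -/
abbrev Gr : Type _ := ⨁ i, 𝓕.Piece i

/-- The class `[a]_i ∈ gr(A)` of an element `a ∈ F^i`. -/
noncomputable def cls (i : ℤ) (a : A) (ha : a ∈ 𝓕.F i) : 𝓕.Gr :=
  DirectSum.lof K ℤ 𝓕.Piece i (𝓕.proj i ⟨a, ha⟩)

theorem cls_congr {i j : ℤ} (h : i = j) {a b : A} (hab : a = b) (ha : a ∈ 𝓕.F i)
    (hb : b ∈ 𝓕.F j) : 𝓕.cls i a ha = 𝓕.cls j b hb := by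
  subst h; subst hab; rfl

theorem cls_mul {i j : ℤ} {a b : A} (ha : a ∈ 𝓕.F i) (hb : b ∈ 𝓕.F j) :
    𝓕.cls i a ha * 𝓕.cls j b hb = 𝓕.cls (i + j) (a * b) (𝓕.mul_mem ha hb) :=
  DirectSum.of_mul_of _ _

theorem cls_one : 𝓕.cls 0 1 𝓕.one_mem = 1 := rfl

theorem cls_sub_eq {i : ℤ} {a b : A} (ha : a ∈ 𝓕.F i) (hb : b ∈ 𝓕.F i)
    (h : a - b ∈ 𝓕.F (i + 1)) : 𝓕.cls i a ha = 𝓕.cls i b hb := by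
  unfold cls
  congr 1
  rw [← sub_eq_zero, ← map_sub]
  exact (𝓕.proj_eq_zero_iff _).2 h

theorem gr_induction {p : 𝓕.Gr → Prop} (h0 : p 0) (hadd : ∀ x y, p x → p y → p (x + y))
    (hcls : ∀ i a (ha : a ∈ 𝓕.F i), p (𝓕.cls i a ha)) (x : 𝓕.Gr) : p x := by
  induction x using DirectSum.induction_on with
  | zero => exact h0
  | of i x =>
    obtain ⟨x, rfl⟩ := 𝓕.proj_surjective i x
    exact hcls i x x.2
  | add x y hx hy => exact hadd x y hx hy

variable {B : Type*} [Ring B] [Algebra K B] {𝓕} {𝓖 : AlgFiltration K B}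

/-- A filtered algebra morphism. -/
def IsFiltered (𝓕 : AlgFiltration K A) (𝓖 : AlgFiltration K B) (f : A →ₐ[K] B) : Prop :=
  ∀ (i : ℤ) (a : A), a ∈ 𝓕.F i → f a ∈ 𝓖.F i

/-- The map `F^i A / F^(i+1) A → F^i B / F^(i+1) B` induced by a filtered morphism. -/
noncomputable def mapPiece (f : A →ₐ[K] B) (hf : IsFiltered 𝓕 𝓖 f) (i : ℤ) :
    𝓕.Piece i →ₗ[K] 𝓖.Piece i :=
  Submodule.mapQ _ _ (f.toLinearMap.restrict (hf i)) (fun a ha => hf (i + 1) a ha)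

theorem mapPiece_proj (f : A →ₐ[K] B) (hf : IsFiltered 𝓕 𝓖 f) (i : ℤ) (a : 𝓕.F i) :
    mapPiece f hf i (𝓕.proj i a) = 𝓖.proj i ⟨f a, hf i a a.2⟩ := rfl

/-- The graded algebra morphism `gr(f) : gr(A) → gr(B)`, `[a]_i ↦ [f(a)]_i`, associated with a
filtered algebra morphism `f`. -/
noncomputable def grMap (f : A →ₐ[K] B) (hf : IsFiltered 𝓕 𝓖 f) : 𝓕.Gr →ₐ[K] 𝓖.Gr :=
  DirectSum.toAlgebra K 𝓕.Piece
    (fun i => DirectSum.lof K ℤ 𝓖.Piece i ∘ₗ mapPiece f hf i)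
    (by
      change 𝓖.cls 0 (f 1) (hf 0 1 𝓕.one_mem) = 1
      rw [← cls_one]
      exact cls_congr _ rfl (map_one f) _ _)
    (by
      intro i j a b
      obtain ⟨a, rfl⟩ := 𝓕.proj_surjective i a
      obtain ⟨b, rfl⟩ := 𝓕.proj_surjective j b
      change 𝓖.cls (i + j) (f (a * b)) (hf _ _ (𝓕.mul_mem a.2 b.2)) =
        𝓖.cls i (f a) (hf _ _ a.2) * 𝓖.cls j (f b) (hf _ _ b.2)
      rw [cls_mul]
      exact cls_congr _ rfl (map_mul f _ _) _ _)

theorem grMap_cls (f : A →ₐ[K] B) (hf : IsFiltered 𝓕 𝓖 f) {i : ℤ} {a : A} (ha : a ∈ 𝓕.F i) :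
    grMap f hf (𝓕.cls i a ha) = 𝓖.cls i (f a) (hf i a ha) := by
  unfold grMap cls
  rw [DirectSum.toAlgebra_apply]
  exact DirectSum.toModule_lof K i _

/-- The filtration induced on a subalgebra. -/
def restrict (𝓕 : AlgFiltration K A) (S : Subalgebra K A) : AlgFiltration K S where
  F i := (𝓕.F i).comap S.val.toLinearMap
  anti _ _ h _ ha := 𝓕.anti h ha
  one_mem := 𝓕.one_mem
  mul_mem ha hb := 𝓕.mul_mem ha hb

theorem isFiltered_val (𝓕 : AlgFiltration K A) (S : Subalgebra K A) :
    IsFiltered (𝓕.restrict S) 𝓕 S.val := fun _ _ h => h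

theorem grMap_val_injective (𝓕 : AlgFiltration K A) (S : Subalgebra K A) :
    Function.Injective (grMap S.val (isFiltered_val 𝓕 S)) := by
  have h : ∀ x i, (grMap S.val (isFiltered_val 𝓕 S) x) i =
      mapPiece S.val (isFiltered_val 𝓕 S) i (x i) := by
    intro x i
    induction x using DirectSum.induction_on with
    | zero => simp
    | add x y hx hy => rw [map_add, DirectSum.add_apply, DirectSum.add_apply, hx, hy, map_add]
    | of j x =>
      obtain ⟨x, rfl⟩ := (𝓕.restrict S).proj_surjective j x
      change (grMap S.val (isFiltered_val 𝓕 S) ((𝓕.restrict S).cls j x x.2)) i = _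
      rw [grMap_cls]
      unfold cls
      rw [DirectSum.lof_eq_of]
      by_cases hij : j = i
      · subst hij
        rw [DirectSum.of_eq_same, DirectSum.of_eq_same]
        rfl
      · rw [DirectSum.of_eq_of_ne _ _ _ (Ne.symm hij), DirectSum.of_eq_of_ne _ _ _ (Ne.symm hij),
          map_zero]
  rw [injective_iff_map_eq_zero]
  intro x hx
  refine DFinsupp.ext fun i => ?_
  have hi := h x i
  rw [hx] at hi
  obtain ⟨y, hy⟩ := (𝓕.restrict S).proj_surjective i (x i)
  change x i = 0
  rw [← hy] at hi ⊢
  rw [mapPiece_proj] at hi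
  have h1 := (𝓕.proj_eq_zero_iff _).1 hi.symm
  exact ((𝓕.restrict S).proj_eq_zero_iff _).2 h1

/-- The tensor product filtration
`F^m (A ⊗ B) = ∑_{i + j = m} (image of F^i A ⊗ F^j B in A ⊗ B)`. -/
def tensor (𝓕 : AlgFiltration K A) (𝓖 : AlgFiltration K B) : AlgFiltration K (A ⊗[K] B) where
  F m := ⨆ (i : ℤ) (j : ℤ) (_ : i + j = m),
    Submodule.map₂ (TensorProduct.mk K A B) (𝓕.F i) (𝓖.F j)
  anti := by
    intro m n h
    refine iSup_le fun i => iSup_le fun j => iSup_le fun hij => ?_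
    refine le_trans ?_ (le_iSup_of_le i (le_iSup_of_le (m - i) (le_iSup_of_le (by ring) le_rfl)))
    exact Submodule.map₂_le_map₂_right (𝓖.anti (by omega))
  one_mem := by
    have h : TensorProduct.mk K A B 1 1 ∈
        Submodule.map₂ (TensorProduct.mk K A B) (𝓕.F 0) (𝓖.F 0) :=
      Submodule.apply_mem_map₂ _ 𝓕.one_mem 𝓖.one_mem
    exact Submodule.mem_iSup_of_mem 0 (Submodule.mem_iSup_of_mem 0
      (Submodule.mem_iSup_of_mem (zero_add 0) h))
  mul_mem := by
    intro m n x y hx hy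
    have key : (⨆ (i : ℤ) (j : ℤ) (_ : i + j = m),
          Submodule.map₂ (TensorProduct.mk K A B) (𝓕.F i) (𝓖.F j)) *
        (⨆ (i : ℤ) (j : ℤ) (_ : i + j = n),
          Submodule.map₂ (TensorProduct.mk K A B) (𝓕.F i) (𝓖.F j)) ≤
        ⨆ (i : ℤ) (j : ℤ) (_ : i + j = m + n),
          Submodule.map₂ (TensorProduct.mk K A B) (𝓕.F i) (𝓖.F j) := by
      simp only [Submodule.iSup_mul, Submodule.mul_iSup]
      refine iSup_le fun i => iSup_le fun j => iSup_le fun hij =>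
        iSup_le fun k => iSup_le fun l => iSup_le fun hkl => ?_
      refine le_trans ?_ (le_iSup_of_le (k + i) (le_iSup_of_le (l + j)
        (le_iSup_of_le (by omega) le_rfl)))
      rw [Submodule.map₂_eq_span_image2, Submodule.map₂_eq_span_image2, Submodule.span_mul_span,
        Submodule.span_le]
      rintro _ ⟨_, ⟨a, ha, b, hb, rfl⟩, _, ⟨c, hc, d, hd, rfl⟩, rfl⟩
      simp only [TensorProduct.mk_apply, Algebra.TensorProduct.tmul_mul_tmul]
      exact Submodule.apply_mem_map₂ (TensorProduct.mk K A B) (𝓕.mul_mem ha hc) (𝓖.mul_mem hb hd)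
    exact key (Submodule.mul_mem_mul hx hy)

theorem tmul_mem_tensor {i j m : ℤ} (hm : i + j = m) {a : A} {b : B} (ha : a ∈ 𝓕.F i)
    (hb : b ∈ 𝓖.F j) : a ⊗ₜ[K] b ∈ (𝓕.tensor 𝓖).F m :=
  Submodule.mem_iSup_of_mem i (Submodule.mem_iSup_of_mem j (Submodule.mem_iSup_of_mem hm
    (Submodule.apply_mem_map₂ (TensorProduct.mk K A B) ha hb)))

theorem isFiltered_includeLeft (𝓕 : AlgFiltration K A) (𝓖 : AlgFiltration K B) :
    IsFiltered 𝓕 (𝓕.tensor 𝓖) Algebra.TensorProduct.includeLeft :=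
  fun i _ ha => tmul_mem_tensor (add_zero i) ha 𝓖.one_mem

theorem isFiltered_includeRight (𝓕 : AlgFiltration K A) (𝓖 : AlgFiltration K B) :
    IsFiltered 𝓖 (𝓕.tensor 𝓖) Algebra.TensorProduct.includeRight :=
  fun i _ hb => tmul_mem_tensor (zero_add i) 𝓕.one_mem hb

/-- The canonical algebra morphism `gr(A) ⊗ gr(B) → gr(A ⊗ B)`,
`[a]_i ⊗ [b]_j ↦ [a ⊗ b]_(i+j)`. -/
noncomputable def grTensor (𝓕 : AlgFiltration K A) (𝓖 : AlgFiltration K B) :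
    𝓕.Gr ⊗[K] 𝓖.Gr →ₐ[K] (𝓕.tensor 𝓖).Gr :=
  Algebra.TensorProduct.lift (grMap _ (isFiltered_includeLeft 𝓕 𝓖))
    (grMap _ (isFiltered_includeRight 𝓕 𝓖)) (by
      intro x y
      induction x using gr_induction with
      | h0 => simp
      | hadd x x' hx hx' => rw [map_add]; exact hx.add_left hx'
      | hcls i a ha =>
        induction y using gr_induction with
        | h0 => simp
        | hadd y y' hy hy' => rw [map_add]; exact hy.add_right hy'
        | hcls j b hb =>
          rw [grMap_cls, grMap_cls, commute_iff_eq, cls_mul, cls_mul]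
          exact cls_congr _ (add_comm i j) (by simp) _ _)

theorem grTensor_cls_tmul_cls {i j : ℤ} {a : A} {b : B} (ha : a ∈ 𝓕.F i) (hb : b ∈ 𝓖.F j) :
    grTensor 𝓕 𝓖 (𝓕.cls i a ha ⊗ₜ 𝓖.cls j b hb) =
      (𝓕.tensor 𝓖).cls (i + j) (a ⊗ₜ b) (tmul_mem_tensor rfl ha hb) := by
  unfold grTensor
  rw [Algebra.TensorProduct.lift_tmul, grMap_cls, grMap_cls, cls_mul]
  exact cls_congr _ rfl (by simp) _ _

end Gr

end AlgFiltration

section LeftSub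

variable {K V : Type*} [CommRing K] [Ring V] [Algebra K V]

/-- The subalgebra `K + V x` of a `K`-algebra `V`, for `x ∈ V`. -/
def leftSub (K : Type*) {V : Type*} [CommRing K] [Ring V] [Algebra K V] (x : V) :
    Subalgebra K V where
  carrier := {w | ∃ (c : K) (v : V), w = algebraMap K V c + v * x}
  mul_mem' := by
    rintro _ _ ⟨c, v, rfl⟩ ⟨d, u, rfl⟩
    refine ⟨c * d, algebraMap K V c * u + v * algebraMap K V d + v * x * u, ?_⟩
    rw [map_mul, mul_add, add_mul, add_mul, add_mul, add_mul, mul_assoc v _ x, mul_assoc v x,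
      Algebra.commutes d x]
    simp only [mul_assoc]
    abel
  add_mem' := by
    rintro _ _ ⟨c, v, rfl⟩ ⟨d, u, rfl⟩
    exact ⟨c + d, v + u, by rw [map_add, add_mul]; abel⟩
  algebraMap_mem' c := ⟨c, 0, by simp⟩

theorem mul_mem_leftSub (v x : V) : v * x ∈ leftSub K x := ⟨0, v, by simp⟩

/-- An algebra morphism on `K + V x` obtained from a representation of `V` in which `x` acts with
rank one. -/
theorem exists_algHom_leftSub {A M : Type*} [Ring A] [Algebra K A] [AddCommGroup M] [Module K M]
    [Module Aᵐᵒᵖ M] [IsScalarTower K Aᵐᵒᵖ M] [SMulCommClass Aᵐᵒᵖ K M] {x : V}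
    (ρ : V →ₐ[K] Module.End Aᵐᵒᵖ M) (r : M →ₗ[Aᵐᵒᵖ] Aᵐᵒᵖ) (s : M) (hs : r s = 1)
    (hx : ∀ m, ρ x m = r m • ρ x s) :
    ∃ f : leftSub K x →ₐ[K] A, ∀ w, f w = (r (ρ w s)).unop := by
  have hK : ∀ (c : K) (m : M), ρ (algebraMap K V c) m = c • m := by
    intro c m
    rw [AlgHom.commutes]; rfl
  have hr : ∀ (c : K) (m : M), r (c • m) = c • r m := fun c m => r.map_smul_of_tower c m
  refine ⟨AlgHom.ofLinearMap
    { toFun := fun w => (r (ρ w s)).unop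
      map_add' := fun a b => by simp
      map_smul' := fun c a => by simp [hr] } (by simp [hs]) ?_, fun w => rfl⟩
  rintro ⟨_, c, v, rfl⟩ ⟨w, -⟩
  change (r (ρ ((algebraMap K V c + v * x) * w) s)).unop =
    (r (ρ (algebraMap K V c + v * x) s)).unop * (r (ρ w s)).unop
  rw [← MulOpposite.unop_mul]
  congr 1
  simp only [map_mul, map_add, Module.End.mul_apply, LinearMap.add_apply]
  rw [hK, hK, hr, hr, hs, hx (ρ w s)]
  simp [mul_add]

/-- A subalgebra containing a left ideal through `x` contains `K + V x`. -/
theorem leftSub_le {x : V} (E : Subalgebra K V) (U : Submodule K V) (hUE : ∀ u ∈ U, u ∈ E)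
    (hxU : x ∈ U) (hU : ∀ (v : V), ∀ u ∈ U, v * u ∈ U) : leftSub K x ≤ E := by
  rintro _ ⟨c, v, rfl⟩
  exact E.add_mem (E.algebraMap_mem c) (hUE _ (hU v x hxU))

/-- The elements that stabilise a submodule by left multiplication. -/
def leftStab (U : Submodule K V) : Subalgebra K V where
  carrier := {v | ∀ u ∈ U, v * u ∈ U}
  mul_mem' ha hb u hu := by rw [mul_assoc]; exact ha _ (hb _ hu)
  add_mem' ha hb u hu := by rw [add_mul]; exact U.add_mem (ha _ hu) (hb _ hu)
  algebraMap_mem' c u hu := by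
    rw [← Algebra.smul_def]
    exact U.smul_mem c hu

end LeftSub

/-! ### The Betti side -/

section Betti

variable (K : Type*) [CommRing K]

/-- The group algebra `K F₂`. -/
abbrev VB : Type _ := MonoidAlgebra K (FreeGroup (Fin 2))

/-- The group elements `X₀`, `X₁` of `K F₂`, and their integer powers. -/
noncomputable def bX (i : Fin 2) (n : ℤ) : VB K := MonoidAlgebra.of K _ (FreeGroup.of i ^ n)

theorem bX_zero (i : Fin 2) : bX K i 0 = 1 := by
  unfold bX
  rw [zpow_zero, map_one]

theorem bX_add (i : Fin 2) (m n : ℤ) : bX K i (m + n) = bX K i m * bX K i n := by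
  unfold bX
  rw [zpow_add, map_mul]

/-- `W^B = K ⊕ K F₂ (X₁ - 1)`. -/
noncomputable abbrev WB : Subalgebra K (VB K) := leftSub K (bX K 1 1 - 1)

theorem bX_one_neg_one_mem : bX K 1 (-1) ∈ WB K := by
  refine ⟨1, -bX K 1 (-1), ?_⟩
  rw [mul_sub, neg_mul, neg_mul, ← bX_add, map_one, neg_add_cancel, bX_zero]
  simp

/-- `X₁⁻¹ ∈ W^B`. -/
noncomputable def wX1inv : WB K := ⟨bX K 1 (-1), bX_one_neg_one_mem K⟩

/-- `X₀^n (X₁ - 1) ∈ W^B`. -/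
noncomputable def wY (n : ℤ) : WB K := ⟨bX K 0 n * (bX K 1 1 - 1), mul_mem_leftSub _ _⟩

/-- The sum `∑_{k=p}^q f(k)` for arbitrary integers `p`, `q`, equal to `-(f(q+1) + ⋯ + f(p-1))`
when `q < p - 1`. -/
noncomputable def intSum {M : Type*} [AddCommGroup M] (p q : ℤ) (f : ℤ → M) : M :=
  if p - 1 ≤ q then ∑ k ∈ Finset.Icc p q, f k else -∑ k ∈ Finset.Icc (q + 1) (p - 1), f k

/-- The formulas that characterise the Betti harmonic coproduct. -/
def IsBettiCoproduct (Δ : WB K →ₐ[K] WB K ⊗[K] WB K) : Prop :=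
  Δ (wX1inv K) = wX1inv K ⊗ₜ wX1inv K ∧
  ∀ n : ℤ, Δ (wY K n) = wY K n ⊗ₜ 1 + 1 ⊗ₜ wY K n
    - intSum 1 (n - 1) (fun k => wY K k ⊗ₜ[K] wY K (n - k))

variable {K}

theorem WB_hom_ext {A : Type*} [Ring A] [Algebra K A] {f g : WB K →ₐ[K] A}
    (h1 : f (wX1inv K) = g (wX1inv K)) (h2 : ∀ n, f (wY K n) = g (wY K n)) : f = g := by
  let E : Subalgebra K (VB K) := (AlgHom.equalizer f g).map (WB K).val
  have hY : ∀ n, bX K 0 n * (bX K 1 1 - 1) ∈ E := fun n => ⟨wY K n, h2 n, rfl⟩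
  have hX : bX K 1 (-1) ∈ E := ⟨wX1inv K, h1, rfl⟩
  let U : Submodule K (VB K) := Submodule.span K
    {u | ∃ (n : ℤ) (e : VB K), e ∈ E ∧ u = bX K 0 n * (bX K 1 1 - 1) * e}
  have hUE : ∀ u ∈ U, u ∈ E := by
    intro u hu
    have : U ≤ Subalgebra.toSubmodule E := by
      refine Submodule.span_le.2 ?_
      rintro _ ⟨n, e, he, rfl⟩
      exact E.mul_mem (hY n) he
    exact this hu
  have hgen : ∀ e ∈ E, (bX K 1 1 - 1) * e ∈ U := fun e he =>
    Submodule.subset_span ⟨0, e, he, by rw [bX_zero, one_mul]⟩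
  have h0 : ∀ n, bX K 0 n ∈ leftStab U := by
    intro n u hu
    refine Submodule.span_induction (p := fun u _ => bX K 0 n * u ∈ U) ?_ (by simp)
      (fun a b _ _ ha hb => by rw [mul_add]; exact U.add_mem ha hb)
      (fun c a _ ha => by rw [mul_smul_comm]; exact U.smul_mem c ha) hu
    rintro _ ⟨m, e, he, rfl⟩
    exact Submodule.subset_span ⟨n + m, e, he, by rw [bX_add]; simp only [mul_assoc]⟩
  have h1' : bX K 1 1 ∈ leftStab U := by
    intro u hu
    have := U.add_mem hu (hgen u (hUE u hu))
    rwa [sub_mul, one_mul, add_sub_cancel] at this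
  have h1n : bX K 1 (-1) ∈ leftStab U := by
    intro u hu
    have h := U.sub_mem hu (hgen _ (E.mul_mem hX (hUE u hu)))
    rwa [sub_mul, one_mul, ← mul_assoc, ← bX_add, add_neg_cancel, bX_zero, one_mul,
      sub_sub_cancel] at h
  have hall : ∀ w : FreeGroup (Fin 2), MonoidAlgebra.of K _ w ∈ leftStab U := by
    intro w
    induction w using FreeGroup.induction_on with
    | C1 => rw [map_one]; exact Subalgebra.one_mem _
    | of i =>
      fin_cases i
      · simpa [bX] using h0 1
      · simpa [bX] using h1'
    | inv_of i _ =>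
      fin_cases i
      · simpa [bX] using h0 (-1)
      · simpa [bX] using h1n
    | mul a b ha hb => rw [map_mul]; exact Subalgebra.mul_mem _ ha hb
  have hV : ∀ v : VB K, v ∈ leftStab U := by
    intro v
    induction v using MonoidAlgebra.induction_on with
    | of g => exact hall g
    | add a b ha hb => exact Subalgebra.add_mem _ ha hb
    | smul c a ha => exact Subalgebra.smul_mem _ ha c
  have hle : WB K ≤ E := leftSub_le E U hUE (by simpa using hgen 1 E.one_mem) hV
  refine AlgHom.ext fun w => ?_
  obtain ⟨w', hw', h⟩ := hle w.2
  have : w' = w := Subtype.ext h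
  exact this ▸ hw'

theorem exists_WB_hom {A : Type*} [Ring A] [Algebra K A] (y : ℤ → A) (z : A)
    (hz : (1 + y 0) * z = 1) (hz' : z * (1 + y 0) = 1) :
    ∃ f : WB K →ₐ[K] A, f (wX1inv K) = z ∧ ∀ n, f (wY K n) = y n := by
  obtain ⟨r, rs, rt⟩ : ∃ r : (Option ℤ →₀ Aᵐᵒᵖ) →ₗ[Aᵐᵒᵖ] Aᵐᵒᵖ,
      r (Finsupp.single none 1) = 1 ∧
      ∀ n, r (Finsupp.single (some n) 1) = MulOpposite.op (y n) :=
    ⟨Finsupp.linearCombination Aᵐᵒᵖ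
      (fun i : Option ℤ => i.elim (1 : Aᵐᵒᵖ) (fun n => MulOpposite.op (y n))),
      by simp, fun n => by simp⟩
  obtain ⟨sh, sh_none, sh_some⟩ :
      ∃ sh : ℤ → Module.End Aᵐᵒᵖ (Option ℤ →₀ Aᵐᵒᵖ),
        (∀ n, sh n (Finsupp.single none 1) = Finsupp.single none 1) ∧
        ∀ n k, sh n (Finsupp.single (some k) 1) = Finsupp.single (some (n + k)) 1 :=
    ⟨fun n => Finsupp.lmapDomain Aᵐᵒᵖ Aᵐᵒᵖ (Option.map (fun k => n + k)),
      fun n => by simp, fun n k => by simp⟩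
  have sh_add : ∀ m n, sh m * sh n = sh (m + n) := by
    intro m n
    refine Finsupp.lhom_ext' fun i => LinearMap.ext_ring ?_
    cases i <;> simp [sh_none, sh_some, add_assoc]
  have sh_zero : sh 0 = 1 := by
    refine Finsupp.lhom_ext' fun i => LinearMap.ext_ring ?_
    cases i <;> simp [sh_none, sh_some]
  obtain ⟨T, hT⟩ : ∃ T : Module.End Aᵐᵒᵖ (Option ℤ →₀ Aᵐᵒᵖ),
      ∀ m, T m = r m • Finsupp.single (some 0) 1 :=
    ⟨r.smulRight (Finsupp.single (some 0) 1), fun m => rfl⟩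
  obtain ⟨Q, hQ⟩ : ∃ Q : Module.End Aᵐᵒᵖ (Option ℤ →₀ Aᵐᵒᵖ),
      ∀ m, Q m = (r m * MulOpposite.op z) • Finsupp.single (some 0) 1 :=
    ⟨r.smulRight (MulOpposite.op z • Finsupp.single (some 0) 1), fun m => by
      rw [LinearMap.smulRight_apply, smul_smul]⟩
  have e1 : MulOpposite.op z * MulOpposite.op (y 0) = 1 - MulOpposite.op z := by
    rw [eq_sub_iff_add_eq, ← MulOpposite.op_mul, ← MulOpposite.op_add, ← MulOpposite.op_one, ← hz]
    congr 1
    noncomm_ring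
  have e2 : MulOpposite.op (y 0) * MulOpposite.op z = 1 - MulOpposite.op z := by
    rw [eq_sub_iff_add_eq, ← MulOpposite.op_mul, ← MulOpposite.op_add, ← MulOpposite.op_one, ← hz']
    congr 1
    noncomm_ring
  have hTQ : (1 + T) * (1 - Q) = 1 := by
    refine LinearMap.ext fun m => ?_
    simp only [Module.End.mul_apply, LinearMap.add_apply, LinearMap.sub_apply,
      Module.End.one_apply, hT, hQ, map_sub, map_smul, rt, smul_add, smul_smul, mul_assoc, e1,
      mul_sub, mul_one, sub_smul]
    abel
  have hQT : (1 - Q) * (1 + T) = 1 := by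
    refine LinearMap.ext fun m => ?_
    simp only [Module.End.mul_apply, LinearMap.add_apply, LinearMap.sub_apply,
      Module.End.one_apply, hT, hQ, map_add, map_smul, rt, e2, smul_sub, sub_smul, one_smul, smul_smul]
    abel
  obtain ⟨u0, hu0⟩ : ∃ u0 : (Module.End Aᵐᵒᵖ (Option ℤ →₀ Aᵐᵒᵖ))ˣ,
      ∀ n : ℤ, ((u0 ^ n : (Module.End Aᵐᵒᵖ (Option ℤ →₀ Aᵐᵒᵖ))ˣ) :
        Module.End Aᵐᵒᵖ (Option ℤ →₀ Aᵐᵒᵖ)) = sh n := by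
    refine ⟨⟨sh 1, sh (-1), by rw [sh_add]; exact sh_zero, by rw [sh_add]; exact sh_zero⟩, ?_⟩
    intro n
    induction n using Int.induction_on with
    | zero => rw [zpow_zero, sh_zero]; rfl
    | succ n ih => rw [zpow_add_one, Units.val_mul, ih, sh_add]
    | pred n ih => rw [zpow_sub_one, Units.val_mul, ih, Units.inv_mk, sh_add, sub_eq_add_neg]
  let u1 : (Module.End Aᵐᵒᵖ (Option ℤ →₀ Aᵐᵒᵖ))ˣ := ⟨1 + T, 1 - Q, hTQ, hQT⟩
  let ρ : VB K →ₐ[K] Module.End Aᵐᵒᵖ (Option ℤ →₀ Aᵐᵒᵖ) := MonoidAlgebra.lift K _ _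
    ((Units.coeHom _).comp (FreeGroup.lift ![u0, u1]))
  have hρ : ∀ i n, ρ (bX K i n) =
      ((![u0, u1] i ^ n : (Module.End Aᵐᵒᵖ (Option ℤ →₀ Aᵐᵒᵖ))ˣ) :
        Module.End Aᵐᵒᵖ (Option ℤ →₀ Aᵐᵒᵖ)) := by
    intro i n
    simp [ρ, bX]
  have hρ0 : ∀ n : ℤ, ρ (bX K 0 n) = sh n := fun n => (hρ 0 n).trans (hu0 n)
  have hρx : ρ (bX K 1 1 - 1) = T := by
    rw [map_sub, hρ, map_one, zpow_one]
    exact add_sub_cancel_left 1 T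
  have hρinv : ρ (bX K 1 (-1)) = 1 - Q := by
    rw [hρ, zpow_neg_one]
    rfl
  obtain ⟨f, hf⟩ := exists_algHom_leftSub ρ r (Finsupp.single none 1) rs (by
    intro m
    rw [hρx, hT, hT, rs, one_smul])
  refine ⟨f, ?_, fun n => ?_⟩
  · rw [hf]
    change (r (ρ (bX K 1 (-1)) _)).unop = _
    rw [hρinv, LinearMap.sub_apply, hQ, map_sub, map_smul, Module.End.one_apply, rs, rt, one_mul,
      smul_eq_mul, e1, sub_sub_cancel, MulOpposite.unop_op]
  · rw [hf]
    change (r (ρ (bX K 0 n * (bX K 1 1 - 1)) _)).unop = _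
    rw [map_mul, hρx, hρ0, Module.End.mul_apply, hT, rs, one_smul, sh_some, rt, add_zero,
      MulOpposite.unop_op]

variable (K)

theorem wY_zero : wX1inv K * (1 + wY K 0) = 1 ∧ (1 + wY K 0) * wX1inv K = 1 := by
  constructor
  · apply Subtype.ext
    change bX K 1 (-1) * (1 + bX K 0 0 * (bX K 1 1 - 1)) = 1
    rw [bX_zero, one_mul, add_sub_cancel, ← bX_add, neg_add_cancel, bX_zero]
  · apply Subtype.ext
    change (1 + bX K 0 0 * (bX K 1 1 - 1)) * bX K 1 (-1) = 1
    rw [bX_zero, one_mul, add_sub_cancel, ← bX_add, add_neg_cancel, bX_zero]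

theorem existsUnique_isBettiCoproduct : ∃! Δ, IsBettiCoproduct K Δ := by
  refine existsUnique_of_exists_of_unique ?_ fun f g hf hg => ?_
  case refine_2 =>
    refine WB_hom_ext (K := K) (A := WB K ⊗[K] WB K) ?_ ?_
    · exact hf.1.trans hg.1.symm
    · exact fun n => (hf.2 n).trans (hg.2 n).symm
  have h0 : (1 : WB K ⊗[K] WB K) + (wY K 0 ⊗ₜ 1 + 1 ⊗ₜ wY K 0
      - intSum 1 (0 - 1) (fun k => wY K k ⊗ₜ[K] wY K (0 - k))) =
      (1 + wY K 0) ⊗ₜ (1 + wY K 0) := by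
    simp only [intSum, TensorProduct.add_tmul, TensorProduct.tmul_add,
      Algebra.TensorProduct.one_def]
    norm_num
    abel
  obtain ⟨f, h1, h2⟩ := exists_WB_hom (K := K)
    (fun n => wY K n ⊗ₜ 1 + 1 ⊗ₜ wY K n
      - intSum 1 (n - 1) (fun k => wY K k ⊗ₜ[K] wY K (n - k)))
    (wX1inv K ⊗ₜ wX1inv K)
    (by rw [h0, Algebra.TensorProduct.tmul_mul_tmul, (wY_zero K).2]; rfl)
    (by rw [h0, Algebra.TensorProduct.tmul_mul_tmul, (wY_zero K).1]; rfl)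
  exact ⟨f, h1, h2⟩

/-- The Betti harmonic coproduct `Δ^{W,B} : W^B → W^B ⊗ W^B`: the algebra morphism such that
`X₁⁻¹ ↦ X₁⁻¹ ⊗ X₁⁻¹` and `X₀^n (X₁ - 1) ↦ X₀^n (X₁ - 1) ⊗ 1 + 1 ⊗ X₀^n (X₁ - 1)
- ∑_{k=1}^{n-1} X₀^k (X₁ - 1) ⊗ X₀^(n-k) (X₁ - 1)` for `n ∈ ℤ`. -/
noncomputable def deltaB : WB K →ₐ[K] WB K ⊗[K] WB K :=
  (existsUnique_isBettiCoproduct K).choose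

end Betti

/-! ### The filtrations relative to `F₂ → μ_N` -/

section BettiFiltration

/-- `ζ_N = exp(2πi/N)`, as an element of the group `μ_N` of complex `N`-th roots of unity. -/
noncomputable def zetaN (N : ℕ) [NeZero N] : rootsOfUnity N ℂ :=
  (Complex.isPrimitiveRoot_exp N (NeZero.ne N)).toRootsOfUnity

noncomputable instance (N : ℕ) [NeZero N] : Fintype (rootsOfUnity N ℂ) := Fintype.ofFinite _

/-- The group morphism `F₂ → μ_N`, `X₀ ↦ ζ_N`, `X₁ ↦ 1`. -/
noncomputable def toMu (N : ℕ) [NeZero N] : FreeGroup (Fin 2) →* rootsOfUnity N ℂ :=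
  FreeGroup.lift ![zetaN N, 1]

variable (K : Type*) [CommRing K] (N : ℕ) [NeZero N]

/-- The algebra morphism `K F₂ → K μ_N`. -/
noncomputable def algToMu : VB K →ₐ[K] MonoidAlgebra K (rootsOfUnity N ℂ) :=
  MonoidAlgebra.mapDomainAlgHom K K (toMu N)

/-- `I_N = ker(K F₂ → K μ_N)`. -/
noncomputable def idealI : Submodule K (VB K) := LinearMap.ker (algToMu K N).toLinearMap

variable {K N}

theorem idealI_mul_mem_left (v : VB K) {u : VB K} (hu : u ∈ idealI K N) : v * u ∈ idealI K N := by
  have h : algToMu K N u = 0 := hu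
  change algToMu K N (v * u) = 0
  rw [map_mul, h, mul_zero]

theorem idealI_mul_mem_right (v : VB K) {u : VB K} (hu : u ∈ idealI K N) :
    u * v ∈ idealI K N := by
  have h : algToMu K N u = 0 := hu
  change algToMu K N (u * v) = 0
  rw [map_mul, h, zero_mul]

theorem top_mul_idealI_pow (n : ℕ) : ⊤ * idealI K N ^ (n + 1) ≤ idealI K N ^ (n + 1) := by
  rw [pow_succ', ← mul_assoc]
  exact mul_le_mul_left (Submodule.mul_le.2 fun v _ u hu => idealI_mul_mem_left v hu) _

theorem idealI_pow_mul_top (n : ℕ) : idealI K N ^ (n + 1) * ⊤ ≤ idealI K N ^ (n + 1) := by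
  rw [pow_succ, mul_assoc]
  exact mul_le_mul_right (Submodule.mul_le.2 fun u hu v _ => idealI_mul_mem_right v hu) _

theorem idealI_pow_succ_le (n : ℕ) : idealI K N ^ (n + 1 + 1) ≤ idealI K N ^ (n + 1) :=
  calc idealI K N ^ (n + 1 + 1) = idealI K N ^ (n + 1) * idealI K N := pow_succ _ _
    _ ≤ idealI K N ^ (n + 1) * ⊤ := mul_le_mul_right le_top _
    _ ≤ _ := idealI_pow_mul_top n

theorem idealI_pow_anti {m n : ℕ} (hm : 0 < m) (h : m ≤ n) : idealI K N ^ n ≤ idealI K N ^ m := by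
  obtain ⟨m, rfl⟩ := Nat.exists_eq_succ_of_ne_zero hm.ne'
  induction n, h using Nat.le_induction with
  | base => exact le_rfl
  | succ n hn ih =>
    obtain ⟨n, rfl⟩ := Nat.exists_eq_succ_of_ne_zero (show n ≠ 0 by omega)
    exact (idealI_pow_succ_le n).trans ih

variable (K N)

/-- `F^m V^B_N`: `K F₂` for `m ≤ 0`, and `I_N^m` for `m > 0`. -/
noncomputable def filVB (m : ℤ) : Submodule K (VB K) :=
  if m ≤ 0 then ⊤ else idealI K N ^ m.toNat

variable {K N}

theorem filVB_of_nonpos {m : ℤ} (h : m ≤ 0) : filVB K N m = ⊤ := if_pos h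

theorem filVB_of_pos {m : ℤ} (h : 0 < m) : filVB K N m = idealI K N ^ m.toNat :=
  if_neg (not_le.2 h)

theorem filVB_anti : Antitone (filVB K N) := by
  intro m n h
  rcases le_or_gt m 0 with hm | hm
  · rw [filVB_of_nonpos hm]; exact le_top
  · rw [filVB_of_pos hm, filVB_of_pos (hm.trans_le h)]
    exact idealI_pow_anti (by omega) (by omega)

theorem filVB_mul_le (i j : ℤ) : filVB K N i * filVB K N j ≤ filVB K N (i + j) := by
  rcases le_or_gt i 0 with hi | hi
  · rcases le_or_gt j 0 with hj | hj
    · rw [filVB_of_nonpos (show i + j ≤ 0 by omega)]; exact le_top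
    · refine le_trans ?_ (filVB_anti (show i + j ≤ j by omega))
      rw [filVB_of_nonpos hi, filVB_of_pos hj]
      obtain ⟨n, hn⟩ := Nat.exists_eq_succ_of_ne_zero (show j.toNat ≠ 0 by omega)
      rw [hn]
      exact top_mul_idealI_pow n
  · rcases le_or_gt j 0 with hj | hj
    · refine le_trans ?_ (filVB_anti (show i + j ≤ i by omega))
      rw [filVB_of_nonpos hj, filVB_of_pos hi]
      obtain ⟨n, hn⟩ := Nat.exists_eq_succ_of_ne_zero (show i.toNat ≠ 0 by omega)
      rw [hn]
      exact idealI_pow_mul_top n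
    · rw [filVB_of_pos hi, filVB_of_pos hj, filVB_of_pos (by omega), ← pow_add,
        show i.toNat + j.toNat = (i + j).toNat by omega]

variable (K N)

/-- The filtered algebra `V^B_N`. -/
noncomputable def filtVB : AlgFiltration K (VB K) where
  F := filVB K N
  anti := filVB_anti
  one_mem := by rw [filVB_of_nonpos le_rfl]; trivial
  mul_mem ha hb := filVB_mul_le _ _ (Submodule.mul_mem_mul ha hb)

/-- The filtered algebra `W^B_N`, with `F^m W^B_N = W^B_N ∩ F^m V^B_N`. -/
noncomputable def filtWB : AlgFiltration K (WB K) := (filtVB K N).restrict (WB K)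

end BettiFiltration

/-! ### The de Rham side -/

section DeRham

/-- The generators `e₀`, `e₁` and `ζ ∈ μ_N`. -/
inductive DRGen (N : ℕ) : Type
  | e0 : DRGen N
  | e1 : DRGen N
  | root (ζ : rootsOfUnity N ℂ) : DRGen N

/-- The degrees of the generators. -/
def DRGen.deg {N : ℕ} : DRGen N → ℕ
  | .e0 => 1
  | .e1 => 1
  | .root _ => 0

/-- The defining relations of `V^DR_N`. -/
inductive DRRel (K : Type*) [CommRing K] (N : ℕ) :
    FreeAlgebra K (DRGen N) → FreeAlgebra K (DRGen N) → Prop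
  | mul (ζ η : rootsOfUnity N ℂ) : DRRel K N
      (FreeAlgebra.ι K (.root ζ) * FreeAlgebra.ι K (.root η)) (FreeAlgebra.ι K (.root (ζ * η)))
  | one : DRRel K N (FreeAlgebra.ι K (.root 1)) 1
  | comm (ζ : rootsOfUnity N ℂ) : DRRel K N
      (FreeAlgebra.ι K (.root ζ) * FreeAlgebra.ι K .e0)
      (FreeAlgebra.ι K .e0 * FreeAlgebra.ι K (.root ζ))

variable (K : Type*) [CommRing K] (N : ℕ)

/-- The algebra `V^DR_N`. -/
def VDR : Type _ := RingQuot (DRRel K N)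

noncomputable instance : Ring (VDR K N) := inferInstanceAs (Ring (RingQuot (DRRel K N)))

noncomputable instance : Algebra K (VDR K N) :=
  inferInstanceAs (Algebra K (RingQuot (DRRel K N)))

/-- The quotient morphism from the free algebra to `V^DR_N`. -/
noncomputable def mkVDR : FreeAlgebra K (DRGen N) →ₐ[K] VDR K N :=
  RingQuot.mkAlgHom K (DRRel K N)

theorem mkVDR_rel {a b : FreeAlgebra K (DRGen N)} (h : DRRel K N a b) :
    mkVDR K N a = mkVDR K N b := RingQuot.mkAlgHom_rel K h

theorem mkVDR_surjective : Function.Surjective (mkVDR K N) :=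
  RingQuot.mkAlgHom_surjective K (DRRel K N)

/-- The image of a generator in `V^DR_N`. -/
noncomputable def drι (g : DRGen N) : VDR K N :=
  mkVDR K N (FreeAlgebra.ι K g)

/-- The degree `n` part of `V^DR_N`, spanned by the words of degree `n` in the generators. -/
noncomputable def degVDR (n : ℕ) : Submodule K (VDR K N) :=
  Submodule.span K {v | ∃ l : List (DRGen N), (l.map DRGen.deg).sum = n ∧
    v = (l.map (drι K N)).prod}

/-- `W^DR_N = K ⊕ V^DR_N e₁`. -/
noncomputable abbrev WDR : Subalgebra K (VDR K N) := leftSub K (drι K N .e1)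

/-- `z_{n,ζ} = - e₀^(n-1) ζ e₁ ∈ W^DR_N`, for `n ≥ 1`. -/
noncomputable def drZ (n : ℕ) (ζ : rootsOfUnity N ℂ) : WDR K N :=
  ⟨-(drι K N .e0 ^ (n - 1) * drι K N (.root ζ)) * drι K N .e1, mul_mem_leftSub _ _⟩

variable {K N}

theorem drι_mul (ζ η : rootsOfUnity N ℂ) :
    drι K N (.root ζ) * drι K N (.root η) = drι K N (.root (ζ * η)) := by
  unfold drι
  rw [← map_mul]
  exact mkVDR_rel K N (DRRel.mul ζ η)

theorem drι_one : drι K N (.root 1) = 1 := by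
  unfold drι
  rw [mkVDR_rel K N DRRel.one, map_one]

theorem drι_comm (ζ : rootsOfUnity N ℂ) :
    drι K N (.root ζ) * drι K N .e0 = drι K N .e0 * drι K N (.root ζ) := by
  unfold drι
  rw [← map_mul, ← map_mul]
  exact mkVDR_rel K N (DRRel.comm ζ)

/-- The universal property of `V^DR_N`. -/
noncomputable def liftVDR {A : Type*} [Ring A] [Algebra K A] (g : DRGen N → A)
    (hmul : ∀ ζ η, g (.root ζ) * g (.root η) = g (.root (ζ * η)))
    (hone : g (.root 1) = 1) (hcomm : ∀ ζ, g (.root ζ) * g .e0 = g .e0 * g (.root ζ)) :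
    VDR K N →ₐ[K] A :=
  RingQuot.liftAlgHom K ⟨FreeAlgebra.lift K g, by
    rintro _ _ (⟨ζ, η⟩ | _ | ζ)
    · simpa using hmul ζ η
    · simpa using hone
    · simpa using hcomm ζ⟩

theorem liftVDR_ι {A : Type*} [Ring A] [Algebra K A] (g : DRGen N → A)
    (hmul : ∀ ζ η, g (.root ζ) * g (.root η) = g (.root (ζ * η)))
    (hone : g (.root 1) = 1) (hcomm : ∀ ζ, g (.root ζ) * g .e0 = g .e0 * g (.root ζ))
    (x : DRGen N) : liftVDR (K := K) g hmul hone hcomm (drι K N x) = g x := by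
  exact (RingQuot.liftAlgHom_mkAlgHom_apply K (s := DRRel K N) _ _ _).trans
    (FreeAlgebra.lift_ι_apply g x)

theorem VDR_mem_of_gen (E : Subalgebra K (VDR K N)) (h : ∀ g, drι K N g ∈ E) (v : VDR K N) :
    v ∈ E := by
  obtain ⟨a, rfl⟩ := mkVDR_surjective K N v
  induction a using FreeAlgebra.induction with
  | grade0 c => rw [AlgHom.commutes]; exact E.algebraMap_mem c
  | grade1 g => exact h g
  | mul a b ha hb => rw [map_mul]; exact E.mul_mem ha hb
  | add a b ha hb => rw [map_add]; exact E.add_mem ha hb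

theorem WDR_hom_ext {A : Type*} [Ring A] [Algebra K A] {f g : WDR K N →ₐ[K] A}
    (h : ∀ n ζ, 1 ≤ n → f (drZ K N n ζ) = g (drZ K N n ζ)) : f = g := by
  let E : Subalgebra K (VDR K N) := (AlgHom.equalizer f g).map (WDR K N).val
  have hZ : ∀ n ζ, drι K N .e0 ^ n * drι K N (.root ζ) * drι K N .e1 ∈ E := by
    intro n ζ
    have h1 : -(drι K N .e0 ^ n * drι K N (.root ζ)) * drι K N .e1 ∈ E :=
      ⟨drZ K N (n + 1) ζ, h (n + 1) ζ (by omega), rfl⟩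
    rw [neg_mul] at h1
    simpa using E.neg_mem h1
  let U : Submodule K (VDR K N) := Submodule.span K
    {u | ∃ (n : ℕ) (ζ : rootsOfUnity N ℂ) (e : VDR K N), e ∈ E ∧
      u = drι K N .e0 ^ n * drι K N (.root ζ) * drι K N .e1 * e}
  have hUE : ∀ u ∈ U, u ∈ E := by
    intro u hu
    have : U ≤ Subalgebra.toSubmodule E := by
      refine Submodule.span_le.2 ?_
      rintro _ ⟨n, ζ, e, he, rfl⟩
      exact E.mul_mem (hZ n ζ) he
    exact this hu
  have hgen : ∀ e ∈ E, drι K N .e1 * e ∈ U := fun e he =>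
    Submodule.subset_span ⟨0, 1, e, he, by rw [pow_zero, drι_one, one_mul, one_mul]⟩
  have hstab : ∀ v : VDR K N, (∀ n ζ, ∀ e ∈ E,
      v * (drι K N .e0 ^ n * drι K N (.root ζ) * drι K N .e1 * e) ∈ U) → v ∈ leftStab U := by
    intro v hv u hu
    refine Submodule.span_induction (p := fun u _ => v * u ∈ U) ?_ (by simp)
      (fun a b _ _ ha hb => by rw [mul_add]; exact U.add_mem ha hb)
      (fun c a _ ha => by rw [mul_smul_comm]; exact U.smul_mem c ha) hu
    rintro _ ⟨m, ζ, e, he, rfl⟩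
    exact hv m ζ e he
  have hV : ∀ v, v ∈ leftStab U := by
    refine VDR_mem_of_gen _ ?_
    rintro (_ | _ | η)
    · refine hstab _ fun n ζ e he => Submodule.subset_span ⟨n + 1, ζ, e, he, ?_⟩
      rw [pow_succ']
      simp only [mul_assoc]
    · exact fun u hu => hgen u (hUE u hu)
    · refine hstab _ fun n ζ e he => Submodule.subset_span ⟨n, η * ζ, e, he, ?_⟩
      have hc : drι K N (.root η) * drι K N .e0 ^ n = drι K N .e0 ^ n * drι K N (.root η) :=
        Commute.pow_right (drι_comm η) n
      rw [← drι_mul]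
      simp only [← mul_assoc]
      rw [hc]
  have hle : WDR K N ≤ E := leftSub_le E U hUE (by simpa using hgen 1 E.one_mem) hV
  refine AlgHom.ext fun w => ?_
  obtain ⟨w', hw', h⟩ := hle w.2
  have : w' = w := Subtype.ext h
  exact this ▸ hw'

theorem exists_WDR_hom {A : Type*} [Ring A] [Algebra K A] (z : ℕ → rootsOfUnity N ℂ → A) :
    ∃ f : WDR K N →ₐ[K] A, ∀ n ζ, 1 ≤ n → f (drZ K N n ζ) = z n ζ := by
  obtain ⟨r, rs, rt⟩ : ∃ r : (Option (ℕ × rootsOfUnity N ℂ) →₀ Aᵐᵒᵖ) →ₗ[Aᵐᵒᵖ] Aᵐᵒᵖ,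
      r (Finsupp.single none 1) = 1 ∧
      ∀ n ζ, r (Finsupp.single (some (n, ζ)) 1) = -MulOpposite.op (z (n + 1) ζ) :=
    ⟨Finsupp.linearCombination Aᵐᵒᵖ
      (fun i : Option (ℕ × rootsOfUnity N ℂ) =>
        i.elim (1 : Aᵐᵒᵖ) (fun p => -MulOpposite.op (z (p.1 + 1) p.2))),
      by simp, fun n ζ => by simp⟩
  obtain ⟨g0, g0_none, g0_some⟩ :
      ∃ g0 : Module.End Aᵐᵒᵖ (Option (ℕ × rootsOfUnity N ℂ) →₀ Aᵐᵒᵖ),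
        g0 (Finsupp.single none 1) = Finsupp.single none 1 ∧
        ∀ n ζ, g0 (Finsupp.single (some (n, ζ)) 1) = Finsupp.single (some (n + 1, ζ)) 1 :=
    ⟨Finsupp.lmapDomain Aᵐᵒᵖ Aᵐᵒᵖ (Option.map (fun p => (p.1 + 1, p.2))),
      by simp, fun n ζ => by simp⟩
  obtain ⟨gr, gr_none, gr_some⟩ :
      ∃ gr : rootsOfUnity N ℂ → Module.End Aᵐᵒᵖ (Option (ℕ × rootsOfUnity N ℂ) →₀ Aᵐᵒᵖ),
        (∀ η, gr η (Finsupp.single none 1) = Finsupp.single none 1) ∧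
        ∀ η n ζ, gr η (Finsupp.single (some (n, ζ)) 1) = Finsupp.single (some (n, η * ζ)) 1 :=
    ⟨fun η => Finsupp.lmapDomain Aᵐᵒᵖ Aᵐᵒᵖ (Option.map (fun p => (p.1, η * p.2))),
      fun η => by simp, fun η n ζ => by simp⟩
  obtain ⟨T, hT⟩ : ∃ T : Module.End Aᵐᵒᵖ (Option (ℕ × rootsOfUnity N ℂ) →₀ Aᵐᵒᵖ),
      ∀ m, T m = r m • Finsupp.single (some (0, 1)) 1 :=
    ⟨r.smulRight (Finsupp.single (some (0, 1)) 1), fun m => rfl⟩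
  let g : DRGen N → Module.End Aᵐᵒᵖ (Option (ℕ × rootsOfUnity N ℂ) →₀ Aᵐᵒᵖ)
    | .e0 => g0
    | .e1 => T
    | .root ζ => gr ζ
  have hmul : ∀ ζ η, g (.root ζ) * g (.root η) = g (.root (ζ * η)) := by
    intro ζ η
    change gr ζ * gr η = gr (ζ * η)
    refine Finsupp.lhom_ext' fun i => LinearMap.ext_ring ?_
    rcases i with _ | ⟨n, ξ⟩ <;> simp [gr_none, gr_some, mul_assoc]
  have hone : g (.root 1) = 1 := by
    change gr 1 = 1
    refine Finsupp.lhom_ext' fun i => LinearMap.ext_ring ?_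
    rcases i with _ | ⟨n, ξ⟩ <;> simp [gr_none, gr_some]
  have hcomm : ∀ ζ, g (.root ζ) * g .e0 = g .e0 * g (.root ζ) := by
    intro ζ
    change gr ζ * g0 = g0 * gr ζ
    refine Finsupp.lhom_ext' fun i => LinearMap.ext_ring ?_
    rcases i with _ | ⟨n, ξ⟩ <;> simp [gr_none, gr_some, g0_none, g0_some]
  let ρ : VDR K N →ₐ[K] Module.End Aᵐᵒᵖ (Option (ℕ × rootsOfUnity N ℂ) →₀ Aᵐᵒᵖ) :=
    liftVDR g hmul hone hcomm
  have hρ1 : ρ (drι K N .e1) = T := liftVDR_ι g hmul hone hcomm .e1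
  have hρ0 : ρ (drι K N .e0) = g0 := liftVDR_ι g hmul hone hcomm .e0
  have hρr : ∀ ζ, ρ (drι K N (.root ζ)) = gr ζ := fun ζ => liftVDR_ι g hmul hone hcomm (.root ζ)
  have g0_pow : ∀ n ζ, (g0 ^ n) (Finsupp.single (some (0, ζ)) 1) =
      Finsupp.single (some (n, ζ)) 1 := by
    intro n ζ
    induction n with
    | zero => simp
    | succ n ih => rw [pow_succ', Module.End.mul_apply, ih, g0_some]
  obtain ⟨f, hf⟩ := exists_algHom_leftSub ρ r (Finsupp.single none 1) rs (by
    intro m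
    rw [hρ1, hT, hT, rs, one_smul])
  refine ⟨f, fun n ζ hn => ?_⟩
  rw [hf]
  change (r (ρ (-(drι K N .e0 ^ (n - 1) * drι K N (.root ζ)) * drι K N .e1) _)).unop = _
  rw [map_mul, map_neg, map_mul, map_pow, hρ0, hρ1, hρr, Module.End.mul_apply, hT, rs, one_smul,
    LinearMap.neg_apply, Module.End.mul_apply, gr_some, g0_pow, map_neg, rt, mul_one,
    Nat.sub_add_cancel hn, neg_neg, MulOpposite.unop_op]

variable (K N) [NeZero N]

/-- The formulas that characterise the de Rham harmonic coproduct. -/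
def IsDeRhamCoproduct (Δ : WDR K N →ₐ[K] WDR K N ⊗[K] WDR K N) : Prop :=
  ∀ (n : ℕ) (ζ : rootsOfUnity N ℂ), 1 ≤ n →
    Δ (drZ K N n ζ) = drZ K N n ζ ⊗ₜ 1 + 1 ⊗ₜ drZ K N n ζ +
      ∑ k ∈ Finset.Icc 1 (n - 1), ∑ η : rootsOfUnity N ℂ,
        drZ K N k η ⊗ₜ[K] drZ K N (n - k) (ζ * η⁻¹)

theorem existsUnique_isDeRhamCoproduct : ∃! Δ, IsDeRhamCoproduct K N Δ := by
  refine existsUnique_of_exists_of_unique ?_ fun f g hf hg => ?_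
  · exact exists_WDR_hom (K := K) (A := WDR K N ⊗[K] WDR K N) _
  · exact WDR_hom_ext (K := K) (A := WDR K N ⊗[K] WDR K N)
      fun n ζ hn => (hf n ζ hn).trans (hg n ζ hn).symm

/-- The de Rham cyclotomic harmonic coproduct `Δ^{W,DR}_N`: the algebra morphism such that
`z_{n,ζ} ↦ z_{n,ζ} ⊗ 1 + 1 ⊗ z_{n,ζ} + ∑_{k=1}^{n-1} ∑_{η ∈ μ_N} z_{k,η} ⊗ z_{n-k,ζη⁻¹}`. -/
noncomputable def deltaDR : WDR K N →ₐ[K] WDR K N ⊗[K] WDR K N :=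
  (existsUnique_isDeRhamCoproduct K N).choose

end DeRham

/-! ### The comparison of `V^DR_N`, `W^DR_N` with `gr(V^B_N)`, `gr(W^B_N)` -/

section Rho

variable (K : Type*) [CommRing K] (N : ℕ) [NeZero N]

theorem filtVB_zero (v : VB K) : v ∈ (filtVB K N).F 0 := by
  change v ∈ filVB K N 0
  rw [filVB_of_nonpos le_rfl]
  trivial

theorem mem_filtVB_one {v : VB K} (h : v ∈ idealI K N) : v ∈ (filtVB K N).F 1 := by
  change v ∈ filVB K N 1
  rw [filVB_of_pos one_pos]
  simpa using h

theorem zetaN_pow : zetaN N ^ N = 1 := by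
  apply Subtype.ext
  exact (zetaN N).2

theorem zetaN_orderOf : orderOf (zetaN N) = N := by
  have h := (Complex.isPrimitiveRoot_exp N (NeZero.ne N)).eq_orderOf
  rw [← Subgroup.orderOf_coe, ← orderOf_units]
  exact h.symm

theorem mem_zpowers_zetaN (ζ : rootsOfUnity N ℂ) : ζ ∈ Subgroup.zpowers (zetaN N) := by
  have h : IsPrimitiveRoot ((zetaN N : rootsOfUnity N ℂ) : ℂˣ) N :=
    IsPrimitiveRoot.coe_units_iff.1 (Complex.isPrimitiveRoot_exp N (NeZero.ne N))
  have h2 : (ζ : ℂˣ) ∈ Subgroup.zpowers ((zetaN N : rootsOfUnity N ℂ) : ℂˣ) := by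
    rw [h.zpowers_eq]
    exact ζ.2
  obtain ⟨k, hk⟩ := h2
  exact ⟨k, Subtype.ext hk⟩

theorem bX_zero_N_sub_one_mem : bX K 0 N - 1 ∈ idealI K N := by
  change algToMu K N (bX K 0 N - 1) = 0
  rw [map_sub, map_one, sub_eq_zero]
  have h : toMu N (FreeGroup.of 0 ^ (N : ℤ)) = 1 := by
    rw [map_zpow, zpow_natCast]
    simp [toMu, zetaN_pow]
  simp only [algToMu, bX, MonoidAlgebra.of_apply, MonoidAlgebra.mapDomainAlgHom_apply,
    MonoidAlgebra.mapDomain_single]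
  rw [h]
  rfl

theorem bX_one_one_sub_one_mem : bX K 1 1 - 1 ∈ idealI K N := by
  change algToMu K N (bX K 1 1 - 1) = 0
  rw [map_sub, map_one, sub_eq_zero]
  have h : toMu N (FreeGroup.of 1 ^ (1 : ℤ)) = 1 := by
    simp [toMu]
  simp only [algToMu, bX, MonoidAlgebra.of_apply, MonoidAlgebra.mapDomainAlgHom_apply,
    MonoidAlgebra.mapDomain_single]
  rw [h]
  rfl

/-- The class `[X₀]₀`, as a unit of `gr(V^B_N)`. -/
noncomputable def clsX0 : ((filtVB K N).Gr)ˣ where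
  val := (filtVB K N).cls 0 (bX K 0 1) (filtVB_zero K N _)
  inv := (filtVB K N).cls 0 (bX K 0 (-1)) (filtVB_zero K N _)
  val_inv := by
    rw [AlgFiltration.cls_mul, ← AlgFiltration.cls_one]
    exact AlgFiltration.cls_congr _ rfl (by rw [← bX_add, add_neg_cancel, bX_zero]) _ _
  inv_val := by
    rw [AlgFiltration.cls_mul, ← AlgFiltration.cls_one]
    exact AlgFiltration.cls_congr _ rfl (by rw [← bX_add, neg_add_cancel, bX_zero]) _ _

theorem clsX0_pow_val (n : ℕ) : ((clsX0 K N ^ n : ((filtVB K N).Gr)ˣ) : (filtVB K N).Gr) =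
    (filtVB K N).cls 0 (bX K 0 n) (filtVB_zero K N _) := by
  induction n with
  | zero =>
    rw [pow_zero, Units.val_one, ← AlgFiltration.cls_one]
    exact AlgFiltration.cls_congr _ rfl (bX_zero K 0).symm _ _
  | succ n ih =>
    rw [pow_succ, Units.val_mul, ih]
    change (filtVB K N).cls 0 _ _ * (filtVB K N).cls 0 _ _ = _
    rw [AlgFiltration.cls_mul]
    exact AlgFiltration.cls_congr _ rfl (by rw [← bX_add]; push_cast; rfl) _ _

theorem clsX0_pow : clsX0 K N ^ N = 1 := by
  apply Units.ext
  rw [clsX0_pow_val, Units.val_one, ← AlgFiltration.cls_one]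
  refine AlgFiltration.cls_sub_eq _ _ _ ?_
  exact mem_filtVB_one K N (bX_zero_N_sub_one_mem K N)

/-- The group morphism `μ_N → gr(V^B_N)ˣ`, `ζ_N ↦ [X₀]₀`. -/
noncomputable def muToGr : rootsOfUnity N ℂ →* ((filtVB K N).Gr)ˣ :=
  monoidHomOfForallMemZpowers (mem_zpowers_zetaN N) (g' := clsX0 K N) (by
    rw [zetaN_orderOf]
    exact orderOf_dvd_of_pow_eq_one (clsX0_pow K N))

theorem muToGr_zetaN : muToGr K N (zetaN N) = clsX0 K N :=
  monoidHomOfForallMemZpowers_apply_gen _ _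

/-- The images of the generators under `ρ^V_N`. -/
noncomputable def rhoGen : DRGen N → (filtVB K N).Gr
  | .e0 => (filtVB K N).cls 1 (bX K 0 N - 1) (mem_filtVB_one K N (bX_zero_N_sub_one_mem K N))
  | .e1 => (filtVB K N).cls 1 (bX K 1 1 - 1) (mem_filtVB_one K N (bX_one_one_sub_one_mem K N))
  | .root ζ => muToGr K N ζ

theorem commute_clsX0 : Commute ((clsX0 K N : ((filtVB K N).Gr)ˣ) : (filtVB K N).Gr)
    (rhoGen K N .e0) := by
  change (filtVB K N).cls 0 _ _ * (filtVB K N).cls 1 _ _ =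
    (filtVB K N).cls 1 _ _ * (filtVB K N).cls 0 _ _
  rw [AlgFiltration.cls_mul, AlgFiltration.cls_mul]
  refine AlgFiltration.cls_congr _ (by norm_num) ?_ _ _
  rw [mul_sub, sub_mul, ← bX_add, ← bX_add, add_comm, mul_one, one_mul]

/-- The graded algebra morphism `ρ^V_N : V^DR_N → gr(V^B_N)`,
`ζ_N ↦ [X₀]₀`, `e₀ ↦ [X₀^N - 1]₁`, `e₁ ↦ [X₁ - 1]₁`. -/
noncomputable def rhoV : VDR K N →ₐ[K] (filtVB K N).Gr :=
  liftVDR (rhoGen K N)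
    (fun ζ η => by
      change (muToGr K N ζ : (filtVB K N).Gr) * muToGr K N η = muToGr K N (ζ * η)
      rw [map_mul, Units.val_mul])
    (by
      change ((muToGr K N 1 : ((filtVB K N).Gr)ˣ) : (filtVB K N).Gr) = 1
      rw [map_one, Units.val_one])
    (fun ζ => by
      obtain ⟨k, rfl⟩ := mem_zpowers_zetaN N ζ
      change ((muToGr K N (zetaN N ^ k) : ((filtVB K N).Gr)ˣ) : (filtVB K N).Gr) *
        rhoGen K N .e0 = rhoGen K N .e0 * (muToGr K N (zetaN N ^ k) : ((filtVB K N).Gr)ˣ)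
      rw [map_zpow, muToGr_zetaN]
      exact (commute_clsX0 K N).units_zpow_left k)

/-- The morphism `gr(W^B_N) → gr(V^B_N)` induced by the inclusion. -/
noncomputable def grIncl : (filtWB K N).Gr →ₐ[K] (filtVB K N).Gr :=
  AlgFiltration.grMap (WB K).val (AlgFiltration.isFiltered_val (filtVB K N) (WB K))

theorem grIncl_injective : Function.Injective (grIncl K N) :=
  AlgFiltration.grMap_val_injective (filtVB K N) (WB K)

theorem rhoV_mem_range (w : WDR K N) : rhoV K N w ∈ (grIncl K N).range := by
  obtain ⟨_, c, v, rfl⟩ := w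
  change rhoV K N (algebraMap K _ c + v * drι K N .e1) ∈ _
  rw [map_add, AlgHom.commutes, map_mul]
  refine Subalgebra.add_mem _ (Subalgebra.algebraMap_mem _ c) ?_
  rw [show rhoV K N (drι K N .e1) = rhoGen K N .e1 from liftVDR_ι _ _ _ _ _]
  generalize rhoV K N v = x
  induction x using AlgFiltration.gr_induction with
  | h0 => rw [zero_mul]; exact Subalgebra.zero_mem _
  | hadd x y hx hy => rw [add_mul]; exact Subalgebra.add_mem _ hx hy
  | hcls i a ha =>
    have h := (filtVB K N).mul_mem ha (mem_filtVB_one K N (bX_one_one_sub_one_mem K N))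
    refine ⟨(filtWB K N).cls (i + 1) ⟨a * (bX K 1 1 - 1), mul_mem_leftSub _ _⟩ h, ?_⟩
    change grIncl K N ((filtWB K N).cls _ _ _) = (filtVB K N).cls i a ha * (filtVB K N).cls 1 _ _
    rw [AlgFiltration.cls_mul]
    exact AlgFiltration.grMap_cls _ _ _

/-- The morphism `ρ^W_N : W^DR_N → gr(W^B_N)` induced by `ρ^V_N`. -/
noncomputable def rhoW : WDR K N →ₐ[K] (filtWB K N).Gr :=
  (AlgEquiv.ofInjective (grIncl K N) (grIncl_injective K N)).symm.toAlgHom.comp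
    (((rhoV K N).comp (WDR K N).val).codRestrict (grIncl K N).range (rhoV_mem_range K N))

theorem grIncl_rhoW (w : WDR K N) : grIncl K N (rhoW K N w) = rhoV K N w :=
  congrArg Subtype.val ((AlgEquiv.ofInjective (grIncl K N) (grIncl_injective K N)).apply_symm_apply
    ⟨rhoV K N w, rhoV_mem_range K N w⟩)

/-- The associated graded morphism `gr(Δ^{W,B}) : gr(W^B_N) → gr(W^B_N) ⊗ gr(W^B_N)`, that is
`gr(W^B_N) → gr(W^B_N ⊗ W^B_N)` followed by the inverse of the canonical morphism
`gr(W^B_N) ⊗ gr(W^B_N) → gr(W^B_N ⊗ W^B_N)`; it is defined as soon as `Δ^{W,B}` is filtered and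
the canonical morphism is bijective. -/
noncomputable def grDeltaB
    (hΔ : AlgFiltration.IsFiltered (filtWB K N) ((filtWB K N).tensor (filtWB K N)) (deltaB K))
    (hcan : Function.Bijective (AlgFiltration.grTensor (filtWB K N) (filtWB K N))) :
    (filtWB K N).Gr →ₐ[K] (filtWB K N).Gr ⊗[K] (filtWB K N).Gr :=
  (AlgEquiv.ofBijective (AlgFiltration.grTensor (filtWB K N) (filtWB K N)) hcan).symm.toAlgHom.comp
    (AlgFiltration.grMap (deltaB K) hΔ)

end Rho

/-! The morphism ρ^V is inverted by a noncommutative expansion: X₀ ↦ ζ_N(1 + e₀X/N), X₁ ↦ 1 + e₁X in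
V^DR⟦X⟧. At X = 0 it factors through K μ_N, so I_N^m goes to series of order at least m, and leading
coefficients define a multiplicative map `sigmaV` on gr(V^B). The factor 1/N makes the expansion of
X₀^N - 1 start with e₀X, whence `sigmaV_rhoV`. Surjectivity holds because X₀^N - 1 and X₁ - 1
generate I_N as a two-sided ideal (`idealI_le_idealJ`), so the classes of degrees 0 and 1 generate
gr(V^B).

To pass to W, note that right multiplication by e₁ is injective on V^DR. Transported by ρ^V, this
makes right multiplication by X₁ - 1 strict (`mem_filtVB_of_mul_mem`), hence F^m W^B = F^(m-1)V^B ·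
(X₁ - 1) for m > 0 (`filtWB_eq_mul`), and ρ^W is bijective.

Since K is not a field, the canonical map gr ⊗ gr → gr needs an argument. Leading coefficients,
followed by a linear retraction V^DR → W^DR, are defined on all of W^B and identify gr(W^B) with
W^DR; their convolutions on W^B ⊗ W^B detect the image of gr ⊗ gr (`grTensor_bijective`).

For the coproduct, the elements (X₀^N - 1)^m X₀^a (X₁ - 1) represent, up to sign, the images of the
z_{m+1,ζ} with ζ = ζ_N^a. They are m-fold differences with step N of n ↦ X₀^n (X₁ - 1), and the
quadratic term of Δ^{W,B} is a geometric-type sum whose differences have a closed form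
(`mixedDiff_succ`). The result, `deltaB_diffY`, is the de Rham formula plus a remainder in F^(m+2),
which gives the commutative diagram on generators. These elements do not by themselves control all
of F^m W^B; that Δ^{W,B} is filtered follows from the left ideals `deltaIdeal`, which Δ^{W,B} maps
into the right step and whose index goes up by one under multiplication by I_N
(`idealI_mul_deltaIdeal_le`). -/

/-! ### The retraction of `V^DR_N` onto `W^DR_N` -/

section DeRhamRetraction

variable (K : Type*) [CommRing K] (N : ℕ)

/-- The augmentation of `V^DR_N`: `e₀, e₁ ↦ 0` and `ζ ↦ 1` for `ζ ∈ μ_N`. -/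
noncomputable def augDR : VDR K N →ₐ[K] K :=
  liftVDR (fun g => match g with
    | .e0 => 0
    | .e1 => 0
    | .root _ => 1) (by simp) rfl (by simp)

theorem augDR_e1 : augDR K N (drι K N .e1) = 0 := liftVDR_ι _ _ _ _ _

theorem augDR_e0 : augDR K N (drι K N .e0) = 0 := liftVDR_ι _ _ _ _ _

theorem augDR_root (ζ : rootsOfUnity N ℂ) : augDR K N (drι K N (.root ζ)) = 1 :=
  liftVDR_ι _ _ _ _ _

/-- The triangular representation of `V^DR_N` whose off-diagonal entry is the derivation dual
to `e₁`. -/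
noncomputable def triDR : VDR K N →ₐ[K] Matrix (Fin 2) (Fin 2) (VDR K N) :=
  liftVDR (fun g => match g with
    | .e0 => !![drι K N .e0, 0; 0, 0]
    | .e1 => !![drι K N .e1, 1; 0, 0]
    | .root ζ => !![drι K N (.root ζ), 0; 0, 1])
    (fun ζ η => by simp [drι_mul])
    (by simp [drι_one, Matrix.one_fin_two])
    (fun ζ => by simp [drι_comm])

/-- With these diagonal entries, the entry D in position (0, 1) obeys the Fox rule D(ab) = a D(b) +
D(a) ε(b), where ε is the augmentation. Since ε(e₁) = 0 and D(e₁) = 1, it undoes right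
multiplication by e₁. -/
theorem triDR_shape (v : VDR K N) : triDR K N v 0 0 = v ∧ triDR K N v 1 0 = 0 ∧
    triDR K N v 1 1 = algebraMap K _ (augDR K N v) := by
  obtain ⟨a, rfl⟩ := mkVDR_surjective K N v
  induction a using FreeAlgebra.induction with
  | grade0 c =>
    rw [AlgHom.commutes, AlgHom.commutes, AlgHom.commutes]
    simp [Matrix.algebraMap_matrix_apply]
  | grade1 g =>
    change triDR K N (drι K N g) 0 0 = drι K N g ∧ triDR K N (drι K N g) 1 0 = 0 ∧
      triDR K N (drι K N g) 1 1 = algebraMap K _ (augDR K N (drι K N g))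
    rw [show triDR K N (drι K N g) = _ from liftVDR_ι _ _ _ _ _]
    cases g <;> simp [augDR_e0, augDR_e1, augDR_root]
  | mul a b ha hb =>
    simp only [map_mul, Matrix.mul_apply, Fin.sum_univ_two]
    simp [ha, hb]
  | add a b ha hb => simp [ha, hb]

/-- The linear map `V^DR_N → V^DR_N` that removes the last letter `e₁`. -/
noncomputable def foxDR : VDR K N →ₗ[K] VDR K N where
  toFun v := triDR K N v 0 1
  map_add' a b := by simp
  map_smul' c a := by simp

theorem foxDR_mul_e1 (v : VDR K N) : foxDR K N (v * drι K N .e1) = v := by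
  change triDR K N (v * drι K N .e1) 0 1 = v
  rw [map_mul, Matrix.mul_apply, Fin.sum_univ_two, (triDR_shape K N v).1,
    show triDR K N (drι K N .e1) = _ from liftVDR_ι _ _ _ _ _]
  simp

theorem foxDR_algebraMap (c : K) : foxDR K N (algebraMap K _ c) = 0 := by
  change triDR K N (algebraMap K _ c) 0 1 = 0
  rw [AlgHom.commutes]
  simp [Matrix.algebraMap_matrix_apply]

theorem mul_e1_injective {v : VDR K N} (h : v * drι K N .e1 = 0) : v = 0 := by
  rw [← foxDR_mul_e1 K N v, h, map_zero]

/-- A linear retraction of the inclusion `W^DR_N ⊂ V^DR_N`. -/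
noncomputable def retractDR : VDR K N →ₗ[K] WDR K N :=
  LinearMap.codRestrict (Subalgebra.toSubmodule (WDR K N))
    ((Algebra.linearMap K (VDR K N)) ∘ₗ (augDR K N).toLinearMap +
      LinearMap.mulRight K (drι K N .e1) ∘ₗ foxDR K N)
    (fun v => ⟨augDR K N v, foxDR K N v, rfl⟩)

theorem retractDR_coe (w : WDR K N) : retractDR K N w = w := by
  obtain ⟨_, c, v, rfl⟩ := w
  apply Subtype.ext
  change algebraMap K _ (augDR K N (algebraMap K _ c + v * drι K N .e1)) +
    foxDR K N (algebraMap K _ c + v * drι K N .e1) * drι K N .e1 =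
    algebraMap K _ c + v * drι K N .e1
  rw [map_add (augDR K N), map_add (foxDR K N), foxDR_mul_e1, foxDR_algebraMap,
    map_mul, augDR_e1, AlgHom.commutes]
  simp

end DeRhamRetraction

/-! ### Generators of the ideal `I_N` -/

section IdealGenerators

variable (K : Type*) [CommRing K] (N : ℕ)

/-- The two-sided ideal of `K F₂` generated by `X₀^N - 1` and `X₁ - 1`. -/
noncomputable def idealJ : Submodule K (VB K) :=
  ⊤ * Submodule.span K {bX K 0 N - 1, bX K 1 1 - 1} * ⊤

variable {K N}

theorem idealJ_mul_mem_left (v : VB K) {u : VB K} (hu : u ∈ idealJ K N) : v * u ∈ idealJ K N := by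
  have h : ⊤ * idealJ K N ≤ idealJ K N := by
    unfold idealJ
    rw [← mul_assoc, ← mul_assoc]
    gcongr
    exact le_top
  exact h (Submodule.mul_mem_mul trivial hu)

theorem idealJ_mul_mem_right (v : VB K) {u : VB K} (hu : u ∈ idealJ K N) : u * v ∈ idealJ K N := by
  have h : idealJ K N * ⊤ ≤ idealJ K N := by
    unfold idealJ
    rw [mul_assoc]
    gcongr
    exact le_top
  exact h (Submodule.mul_mem_mul hu trivial)

theorem span_le_idealJ : Submodule.span K {bX K 0 N - 1, bX K 1 1 - 1} ≤ idealJ K N := by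
  intro u hu
  have h1 : (1 : VB K) ∈ (⊤ : Submodule K (VB K)) := trivial
  have h := Submodule.mul_mem_mul (Submodule.mul_mem_mul h1 hu) h1
  rwa [one_mul, mul_one] at h

theorem bX_neg_sub_one_mem_idealJ {i : Fin 2} {n : ℤ} (h : bX K i n - 1 ∈ idealJ K N) :
    bX K i (-n) - 1 ∈ idealJ K N := by
  have h1 := (idealJ K N).neg_mem (idealJ_mul_mem_left (bX K i (-n)) h)
  rwa [mul_sub, ← bX_add, neg_add_cancel, bX_zero, mul_one, neg_sub] at h1

theorem bX_add_sub_one_mem_idealJ {i : Fin 2} {m n : ℤ} (hm : bX K i m - 1 ∈ idealJ K N)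
    (hn : bX K i n - 1 ∈ idealJ K N) : bX K i (m + n) - 1 ∈ idealJ K N := by
  have h1 := (idealJ K N).add_mem (idealJ_mul_mem_right (bX K i n) hm) hn
  rwa [sub_mul, ← bX_add, one_mul, sub_add_sub_cancel] at h1

theorem bX_mul_sub_one_mem_idealJ (k : ℤ) : bX K 0 (N * k) - 1 ∈ idealJ K N := by
  have h : bX K 0 N - 1 ∈ idealJ K N := span_le_idealJ (Submodule.subset_span (by simp))
  induction k using Int.induction_on with
  | zero => rw [mul_zero, bX_zero, sub_self]; exact Submodule.zero_mem _
  | succ n ih => rw [mul_add, mul_one]; exact bX_add_sub_one_mem_idealJ ih h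
  | pred n ih =>
    rw [mul_sub, mul_one, sub_eq_add_neg (_ * _ : ℤ)]
    exact bX_add_sub_one_mem_idealJ ih (bX_neg_sub_one_mem_idealJ h)

variable [NeZero N]

theorem bX_sub_bX_mem_idealJ {m n : ℤ} (h : zetaN N ^ m = zetaN N ^ n) :
    bX K 0 m - bX K 0 n ∈ idealJ K N := by
  have h1 : (N : ℤ) ∣ m - n := by
    rw [← zetaN_orderOf N]
    rw [orderOf_dvd_iff_zpow_eq_one, zpow_sub, h, mul_inv_cancel]
  obtain ⟨k, hk⟩ := h1
  have h2 := idealJ_mul_mem_left (bX K 0 n) (bX_mul_sub_one_mem_idealJ (K := K) (N := N) k)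
  rwa [mul_sub, ← bX_add, mul_one, ← hk, add_sub_cancel] at h2

/-- Modulo the ideal, X₁ becomes 1, so a word collapses to a power of X₀; the exponent is tracked
together with the image in μ_N. -/
theorem exists_sub_bX_mem_idealJ (g : FreeGroup (Fin 2)) :
    ∃ n : ℤ, MonoidAlgebra.of K _ g - bX K 0 n ∈ idealJ K N ∧ toMu N g = zetaN N ^ n := by
  have h1 : bX K 1 1 - 1 ∈ idealJ K N := span_le_idealJ (Submodule.subset_span (by simp))
  induction g using FreeGroup.induction_on with
  | C1 => exact ⟨0, by rw [map_one, bX_zero, sub_self]; exact Submodule.zero_mem _, by simp⟩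
  | of i =>
    fin_cases i
    · exact ⟨1, by simp [bX], by simp [toMu]⟩
    · exact ⟨0, by rw [bX_zero]; simpa [bX] using h1, by simp [toMu]⟩
  | inv_of i _ =>
    fin_cases i
    · exact ⟨-1, by simp [bX], by simp [toMu]⟩
    · exact ⟨0, by rw [bX_zero]; simpa [bX] using bX_neg_sub_one_mem_idealJ h1, by simp [toMu]⟩
  | mul a b ha hb =>
    obtain ⟨m, hm, hm'⟩ := ha
    obtain ⟨n, hn, hn'⟩ := hb
    refine ⟨m + n, ?_, by rw [map_mul, hm', hn', zpow_add]⟩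
    have h := (idealJ K N).add_mem (idealJ_mul_mem_right (MonoidAlgebra.of K _ b) hm)
      (idealJ_mul_mem_left (bX K 0 m) hn)
    rwa [sub_mul, mul_sub, sub_add_sub_cancel, ← map_mul, ← bX_add] at h

/-- A choice of exponents b(ζ) gives a K-linear section θ of K F₂ → K μ_N. Modulo J every v equals θ
of its image, because exponents of X₀ only matter modulo N; on the kernel that image is zero. -/
theorem idealI_le_idealJ : idealI K N ≤ idealJ K N := by
  choose b hb using fun ζ => mem_zpowers_zetaN N ζ
  let θ : MonoidAlgebra K (rootsOfUnity N ℂ) →ₗ[K] VB K :=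
    Finsupp.linearCombination K (fun ζ => bX K 0 (b ζ)) ∘ₗ
      (MonoidAlgebra.coeffLinearEquiv K).toLinearMap
  have hθ : ∀ g, θ (algToMu K N (MonoidAlgebra.of K _ g)) = bX K 0 (b (toMu N g)) := by
    intro g
    simp [θ, algToMu]
  have key : ∀ v : VB K, v - θ (algToMu K N v) ∈ idealJ K N := by
    intro v
    induction v using MonoidAlgebra.induction_on with
    | of g =>
      obtain ⟨n, hn, hn'⟩ := exists_sub_bX_mem_idealJ (K := K) (N := N) g
      rw [hθ]
      have h := (idealJ K N).add_mem hn
        (bX_sub_bX_mem_idealJ (K := K) (hn'.symm.trans (hb (toMu N g)).symm))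
      rwa [sub_add_sub_cancel] at h
    | add u v hu hv =>
      rw [map_add, map_add, add_sub_add_comm]
      exact Submodule.add_mem _ hu hv
    | smul c v hv =>
      rw [map_smul, map_smul, ← smul_sub]
      exact Submodule.smul_mem _ c hv
  intro v hv
  have h := key v
  rwa [show algToMu K N v = 0 from hv, map_zero, sub_zero] at h

end IdealGenerators

/-! ### Arithmetic of classes in an associated graded algebra -/

namespace AlgFiltration

section ClassArithmetic

variable {K A : Type*} [CommRing K] [Ring A] [Algebra K A] (𝓕 : AlgFiltration K A)

theorem cls_eq_zero {i : ℤ} {a : A} (ha : a ∈ 𝓕.F i) (h : a ∈ 𝓕.F (i + 1)) :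
    𝓕.cls i a ha = 0 := by
  unfold cls
  rw [(𝓕.proj_eq_zero_iff _).2 h, map_zero]

theorem cls_eq_zero_iff {i : ℤ} {a : A} (ha : a ∈ 𝓕.F i) :
    𝓕.cls i a ha = 0 ↔ a ∈ 𝓕.F (i + 1) := by
  refine ⟨fun h => ?_, 𝓕.cls_eq_zero ha⟩
  have h1 := DirectSum.of_injective (β := 𝓕.Piece) i (h.trans (map_zero _).symm)
  exact (𝓕.proj_eq_zero_iff _).1 h1

theorem cls_add {i : ℤ} {a b : A} (ha : a ∈ 𝓕.F i) (hb : b ∈ 𝓕.F i) :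
    𝓕.cls i (a + b) (Submodule.add_mem _ ha hb) = 𝓕.cls i a ha + 𝓕.cls i b hb := by
  unfold cls
  rw [← map_add, ← map_add]
  rfl

theorem cls_neg {i : ℤ} {a : A} (ha : a ∈ 𝓕.F i) :
    𝓕.cls i (-a) (Submodule.neg_mem _ ha) = -𝓕.cls i a ha := by
  unfold cls
  rw [← map_neg, ← map_neg]
  rfl

theorem cls_smul {i : ℤ} (c : K) {a : A} (ha : a ∈ 𝓕.F i) :
    𝓕.cls i (c • a) (Submodule.smul_mem _ c ha) = c • 𝓕.cls i a ha := by
  unfold cls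
  rw [← map_smul, ← map_smul]
  rfl

/-- The element `a` belongs to `F^i` and its class in `gr(A)` is `x`. -/
def HasCls (i : ℤ) (a : A) (x : 𝓕.Gr) : Prop := ∃ h : a ∈ 𝓕.F i, 𝓕.cls i a h = x

variable {𝓕}

theorem HasCls.add {i : ℤ} {a b : A} {x y : 𝓕.Gr} (ha : 𝓕.HasCls i a x) (hb : 𝓕.HasCls i b y) :
    𝓕.HasCls i (a + b) (x + y) := by
  obtain ⟨ha, rfl⟩ := ha
  obtain ⟨hb, rfl⟩ := hb
  exact ⟨_, 𝓕.cls_add ha hb⟩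

theorem HasCls.neg {i : ℤ} {a : A} {x : 𝓕.Gr} (ha : 𝓕.HasCls i a x) : 𝓕.HasCls i (-a) (-x) := by
  obtain ⟨ha, rfl⟩ := ha
  exact ⟨_, 𝓕.cls_neg ha⟩

theorem HasCls.sub {i : ℤ} {a b : A} {x y : 𝓕.Gr} (ha : 𝓕.HasCls i a x) (hb : 𝓕.HasCls i b y) :
    𝓕.HasCls i (a - b) (x - y) := by
  rw [sub_eq_add_neg, sub_eq_add_neg]
  exact ha.add hb.neg

theorem hasCls_zero {i : ℤ} {a : A} (ha : a ∈ 𝓕.F (i + 1)) : 𝓕.HasCls i a 0 :=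
  ⟨𝓕.anti (by omega) ha, 𝓕.cls_eq_zero _ ha⟩

theorem HasCls.sum {ι : Type*} {i : ℤ} {s : Finset ι} {f : ι → A} {x : ι → 𝓕.Gr}
    (h : ∀ k ∈ s, 𝓕.HasCls i (f k) (x k)) : 𝓕.HasCls i (∑ k ∈ s, f k) (∑ k ∈ s, x k) := by
  classical
  induction s using Finset.induction_on with
  | empty => exact hasCls_zero (Submodule.zero_mem _)
  | insert a s ha ih =>
    rw [Finset.sum_insert ha, Finset.sum_insert ha]
    exact (h a (Finset.mem_insert_self _ _)).add
      (ih fun k hk => h k (Finset.mem_insert_of_mem hk))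

variable (𝓕)

theorem cls_algebraMap (c : K) (h : algebraMap K A c ∈ 𝓕.F 0) :
    𝓕.cls 0 (algebraMap K A c) h = algebraMap K 𝓕.Gr c := by
  rw [Algebra.algebraMap_eq_smul_one (A := 𝓕.Gr), ← cls_one, ← cls_smul]
  exact 𝓕.cls_congr rfl (Algebra.algebraMap_eq_smul_one c) _ _

/-- The elements of `F^i` whose class lies in a given subalgebra of `gr(A)`. -/
noncomputable def clsPreimage (R : Subalgebra K 𝓕.Gr) (i : ℤ) : Submodule K A where
  carrier := {a | ∃ h : a ∈ 𝓕.F i, 𝓕.cls i a h ∈ R}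
  add_mem' := by
    rintro a b ⟨ha, ha'⟩ ⟨hb, hb'⟩
    exact ⟨Submodule.add_mem _ ha hb, by rw [cls_add _ ha hb]; exact R.add_mem ha' hb'⟩
  zero_mem' := ⟨Submodule.zero_mem _, by
    rw [cls_eq_zero _ _ (Submodule.zero_mem _)]; exact R.zero_mem⟩
  smul_mem' := by
    rintro c a ⟨ha, ha'⟩
    exact ⟨Submodule.smul_mem _ c ha, by rw [cls_smul _ c ha]; exact R.smul_mem ha' c⟩

/-- This multiplicativity reduces the surjectivity of ρ^V to degrees 0 and 1, the positive steps of
the filtration being powers of I_N. -/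
theorem clsPreimage_mul_le (R : Subalgebra K 𝓕.Gr) (i j : ℤ) :
    𝓕.clsPreimage R i * 𝓕.clsPreimage R j ≤ 𝓕.clsPreimage R (i + j) := by
  refine Submodule.mul_le.2 ?_
  rintro a ⟨ha, ha'⟩ b ⟨hb, hb'⟩
  exact ⟨𝓕.mul_mem ha hb, by rw [← cls_mul _ ha hb]; exact R.mul_mem ha' hb'⟩

variable {𝓕} {B : Type*} [AddCommGroup B] [Module K B]

/-- The linear map on `gr(A)` induced by linear maps `c i : A → B` such that `c i` vanishes on
`F^(i+1)`. -/
noncomputable def grLift (c : ℤ → A →ₗ[K] B) (hc : ∀ i, ∀ a ∈ 𝓕.F (i + 1), c i a = 0) :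
    𝓕.Gr →ₗ[K] B :=
  DirectSum.toModule K ℤ B fun i =>
    Submodule.liftQ _ ((c i).domRestrict (𝓕.F i)) (fun a ha => hc i a ha)

theorem grLift_cls (c : ℤ → A →ₗ[K] B) (hc : ∀ i, ∀ a ∈ 𝓕.F (i + 1), c i a = 0) {i : ℤ} {a : A}
    (ha : a ∈ 𝓕.F i) : grLift c hc (𝓕.cls i a ha) = c i a :=
  DirectSum.toModule_lof K i _

end ClassArithmetic

end AlgFiltration

/-! ### Surjectivity of `ρ^V_N` -/

section RhoSurjective

variable (K : Type*) [CommRing K] (N : ℕ) [NeZero N]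

theorem filtVB_of_nonpos {i : ℤ} (hi : i ≤ 0) (v : VB K) : v ∈ (filtVB K N).F i := by
  change v ∈ filVB K N i
  rw [filVB_of_nonpos hi]
  trivial

theorem filtVB_natCast_succ (m : ℕ) : (filtVB K N).F (m + 1 : ℕ) = idealI K N ^ (m + 1) := by
  change filVB K N (m + 1 : ℕ) = _
  rw [filVB_of_pos (by positivity), Int.toNat_natCast]

theorem mem_filtVB_one_iff {v : VB K} : v ∈ (filtVB K N).F 1 ↔ v ∈ idealI K N := by
  have h := filtVB_natCast_succ K N 0
  rw [pow_one] at h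
  rw [← h]
  rfl

theorem rhoV_e0 : rhoV K N (drι K N .e0) = (filtVB K N).cls 1 (bX K 0 N - 1)
    (mem_filtVB_one K N (bX_zero_N_sub_one_mem K N)) := liftVDR_ι _ _ _ _ _

theorem rhoV_e1 : rhoV K N (drι K N .e1) = (filtVB K N).cls 1 (bX K 1 1 - 1)
    (mem_filtVB_one K N (bX_one_one_sub_one_mem K N)) := liftVDR_ι _ _ _ _ _

theorem clsX0_zpow_val (n : ℤ) : ((clsX0 K N ^ n : ((filtVB K N).Gr)ˣ) : (filtVB K N).Gr) =
    (filtVB K N).cls 0 (bX K 0 n) (filtVB_zero K N _) := by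
  obtain ⟨m, rfl | rfl⟩ := n.eq_nat_or_neg
  · rw [zpow_natCast, clsX0_pow_val]
  · rw [zpow_neg, zpow_natCast, ← Units.mul_eq_one_iff_inv_eq, clsX0_pow_val,
      AlgFiltration.cls_mul, ← AlgFiltration.cls_one]
    exact AlgFiltration.cls_congr _ rfl (by rw [← bX_add, add_neg_cancel, bX_zero]) _ _

theorem rhoV_root (n : ℤ) : rhoV K N (drι K N (.root (zetaN N ^ n))) =
    (filtVB K N).cls 0 (bX K 0 n) (filtVB_zero K N _) := by
  rw [rhoV, liftVDR_ι]
  change ((muToGr K N (zetaN N ^ n) : ((filtVB K N).Gr)ˣ) : (filtVB K N).Gr) = _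
  rw [map_zpow, muToGr_zetaN, clsX0_zpow_val]

theorem idealJ_le_idealI : idealJ K N ≤ idealI K N := by
  refine Submodule.mul_le.2 fun a ha b _ => idealI_mul_mem_right b ?_
  refine Submodule.mul_le.2 (fun a _ b hb => idealI_mul_mem_left a ?_) ha
  refine Submodule.span_le.2 ?_ hb
  rintro _ (rfl | rfl)
  · exact bX_zero_N_sub_one_mem K N
  · exact bX_one_one_sub_one_mem K N

theorem clsPreimage_rhoV_zero : (filtVB K N).clsPreimage (rhoV K N).range 0 = ⊤ := by
  refine eq_top_iff.2 fun v _ => ?_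
  induction v using MonoidAlgebra.induction_on with
  | of g =>
    obtain ⟨n, hn, -⟩ := exists_sub_bX_mem_idealJ (K := K) (N := N) g
    refine ⟨filtVB_zero K N _, drι K N (.root (zetaN N ^ n)), ?_⟩
    refine (rhoV_root K N n).trans (Eq.symm ?_)
    exact (filtVB K N).cls_sub_eq _ _ (mem_filtVB_one K N (idealJ_le_idealI K N hn))
  | add a b ha hb => exact Submodule.add_mem _ (ha trivial) (hb trivial)
  | smul c a ha => exact Submodule.smul_mem _ c (ha trivial)

/-- I_N is contained in V · S · V with S spanned by X₀^N - 1 and X₁ - 1. The outer factors have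
classes in the range by the degree 0 case, and the classes of the two generators are the images of
e₀ and e₁. -/
theorem idealI_le_clsPreimage_rhoV :
    idealI K N ≤ (filtVB K N).clsPreimage (rhoV K N).range 1 := by
  have hS : Submodule.span K {bX K 0 N - 1, bX K 1 1 - 1} ≤
      (filtVB K N).clsPreimage (rhoV K N).range 1 := by
    refine Submodule.span_le.2 ?_
    rintro _ (rfl | rfl)
    · exact ⟨mem_filtVB_one K N (bX_zero_N_sub_one_mem K N), _, rhoV_e0 K N⟩
    · exact ⟨mem_filtVB_one K N (bX_one_one_sub_one_mem K N), _, rhoV_e1 K N⟩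
  calc idealI K N ≤ idealJ K N := idealI_le_idealJ
    _ ≤ (filtVB K N).clsPreimage (rhoV K N).range 0 * (filtVB K N).clsPreimage (rhoV K N).range 1
        * (filtVB K N).clsPreimage (rhoV K N).range 0 := by
      rw [clsPreimage_rhoV_zero, idealJ]
      gcongr
    _ ≤ (filtVB K N).clsPreimage (rhoV K N).range (0 + 1)
        * (filtVB K N).clsPreimage (rhoV K N).range 0 := by
      gcongr
      exact AlgFiltration.clsPreimage_mul_le _ _ _ _
    _ ≤ (filtVB K N).clsPreimage (rhoV K N).range (0 + 1 + 0) :=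
      AlgFiltration.clsPreimage_mul_le _ _ _ _

theorem idealI_pow_le_clsPreimage_rhoV (m : ℕ) :
    idealI K N ^ (m + 1) ≤ (filtVB K N).clsPreimage (rhoV K N).range (m + 1 : ℕ) := by
  induction m with
  | zero =>
    rw [pow_one]
    exact idealI_le_clsPreimage_rhoV K N
  | succ m ih =>
    rw [pow_succ]
    exact (mul_le_mul' ih (idealI_le_clsPreimage_rhoV K N)).trans
      (AlgFiltration.clsPreimage_mul_le _ _ _ _)

theorem rhoV_surjective : Function.Surjective (rhoV K N) := by
  intro x
  change x ∈ (rhoV K N).range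
  induction x using AlgFiltration.gr_induction with
  | h0 => exact Subalgebra.zero_mem _
  | hadd x y hx hy => exact Subalgebra.add_mem _ hx hy
  | hcls i a ha =>
    rcases lt_trichotomy i 0 with hi | rfl | hi
    -- In negative degree F^i and F^(i+1) are both everything, so the graded piece vanishes.
    · rw [AlgFiltration.cls_eq_zero _ ha (filtVB_of_nonpos K N (by omega) a)]
      exact Subalgebra.zero_mem _
    · have h : a ∈ (filtVB K N).clsPreimage (rhoV K N).range 0 := by
        rw [clsPreimage_rhoV_zero]
        trivial
      exact h.2
    · obtain ⟨m, rfl⟩ : ∃ m : ℕ, i = (m + 1 : ℕ) := ⟨i.toNat - 1, by omega⟩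
      rw [filtVB_natCast_succ] at ha
      exact (idealI_pow_le_clsPreimage_rhoV K N m ha).2

end RhoSurjective

/-! ### Injectivity of `ρ^V_N` -/

section RhoInjective

open PowerSeries

/-- A power series with invertible constant coefficient, as a unit. -/
noncomputable def serUnit {R : Type*} [Ring R] (f : R⟦X⟧) (u : Rˣ) (h : constantCoeff f = u) :
    (R⟦X⟧)ˣ :=
  ⟨f, invOfUnit f u, mul_invOfUnit f u h, invOfUnit_mul f u h⟩

theorem coeff_mul_eq_zero_of_vanish {R : Type*} [Ring R] {f g : R⟦X⟧} {i j : ℕ}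
    (hf : ∀ n < i, coeff n f = 0) (hg : ∀ n < j, coeff n g = 0) (n : ℕ) (hn : n < i + j) :
    coeff n (f * g) = 0 := by
  rw [coeff_mul]
  refine Finset.sum_eq_zero fun p hp => ?_
  rw [Finset.HasAntidiagonal.mem_antidiagonal] at hp
  rcases lt_or_ge p.1 i with h | h
  · rw [hf _ h, zero_mul]
  · rw [hg _ (by omega), mul_zero]

theorem coeff_add_mul_of_vanish {R : Type*} [Ring R] {f g : R⟦X⟧} {i j : ℕ}
    (hf : ∀ n < i, coeff n f = 0) (hg : ∀ n < j, coeff n g = 0) :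
    coeff (i + j) (f * g) = coeff i f * coeff j g := by
  rw [coeff_mul]
  refine Finset.sum_eq_single (i, j) (fun p hp hne => ?_) (fun h => absurd (by simp) h)
  rw [Finset.HasAntidiagonal.mem_antidiagonal] at hp
  rcases lt_trichotomy p.1 i with h | h | h
  · rw [hf _ h, zero_mul]
  · exact absurd (Prod.ext h (by omega)) hne
  · rw [hg _ (by omega), mul_zero]

variable (K : Type*) [CommRing K] (N : ℕ)

/-- The element `1 + e₁ X` of `V^DR_N⟦X⟧`. -/
noncomputable def serX1 : (VDR K N)⟦X⟧ := 1 + C (drι K N .e1) * X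

theorem constantCoeff_serX1 : constantCoeff (serX1 K N) = (1 : (VDR K N)ˣ) := by
  simp [serX1]

variable [Algebra ℚ K] [NeZero N]

/-- The element `ζ_N (1 + e₀ X / N)` of `V^DR_N⟦X⟧`. -/
noncomputable def serX0 : (VDR K N)⟦X⟧ :=
  C (drι K N (.root (zetaN N))) +
    C (algebraMap ℚ K (N : ℚ)⁻¹ • (drι K N (.root (zetaN N)) * drι K N .e0)) * X

/-- The root of unity `ζ` as a unit of `V^DR_N`. -/
noncomputable def rootUnit : rootsOfUnity N ℂ →* (VDR K N)ˣ where
  toFun ζ := ⟨drι K N (.root ζ), drι K N (.root ζ⁻¹), by rw [drι_mul, mul_inv_cancel, drι_one],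
    by rw [drι_mul, inv_mul_cancel, drι_one]⟩
  map_one' := Units.ext drι_one
  map_mul' ζ η := Units.ext (drι_mul ζ η).symm

theorem constantCoeff_serX0 : constantCoeff (serX0 K N) = rootUnit K N (zetaN N) := by
  simp [serX0, rootUnit]

/-- The algebra morphism `K F₂ → V^DR_N⟦X⟧`, `X₀ ↦ ζ_N (1 + e₀ X / N)`, `X₁ ↦ 1 + e₁ X`. -/
noncomputable def toSeries : VB K →ₐ[K] (VDR K N)⟦X⟧ :=
  MonoidAlgebra.lift K _ _ ((Units.coeHom _).comp (FreeGroup.lift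
    ![serUnit _ _ (constantCoeff_serX0 K N), serUnit _ _ (constantCoeff_serX1 K N)]))

theorem toSeries_bX_zero : toSeries K N (bX K 0 1) = serX0 K N := by
  simp [toSeries, bX, serUnit]

theorem toSeries_bX_one : toSeries K N (bX K 1 1) = serX1 K N := by
  simp [toSeries, bX, serUnit]

/-- At X = 0 the expansion sends X₀ to ζ_N and X₁ to 1. Its constant term thus depends only on the
image in K μ_N, so I_N goes to series without constant term. -/
theorem constantCoeff_toSeries (v : VB K) : constantCoeff (toSeries K N v) =
    MonoidAlgebra.lift K _ _ ((Units.coeHom _).comp (rootUnit K N)) (algToMu K N v) := by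
  induction v using MonoidAlgebra.induction_on with
  | of g =>
    have h : (Units.map (constantCoeff (R := VDR K N)).toMonoidHom).comp (FreeGroup.lift
        ![serUnit _ _ (constantCoeff_serX0 K N), serUnit _ _ (constantCoeff_serX1 K N)]) =
        (rootUnit K N).comp (toMu N) := by
      ext i
      fin_cases i
      · simp [toMu, serUnit, constantCoeff_serX0]
      · simp [toMu, serUnit, constantCoeff_serX1]
    have h1 := congrArg Units.val (DFunLike.congr_fun h g)
    simpa [toSeries, algToMu] using h1
  | add a b ha hb => simp only [map_add, ha, hb]
  | smul c a ha =>
    rw [map_smul, map_smul (algToMu K N), map_smul (MonoidAlgebra.lift K _ _ _), ← ha]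
    rw [← coeff_zero_eq_constantCoeff_apply, ← coeff_zero_eq_constantCoeff_apply, coeff_smul]

/-- The elements of `K F₂` whose expansion has order at least `m`. -/
noncomputable def orderGE (m : ℕ) : Submodule K (VB K) where
  carrier := {v | ∀ n < m, coeff n (toSeries K N v) = 0}
  add_mem' ha hb n hn := by rw [map_add, map_add, ha n hn, hb n hn, add_zero]
  zero_mem' n _ := by rw [map_zero, map_zero]
  smul_mem' c a ha n hn := by
    rw [map_smul]
    exact (coeff_smul n _ c).trans (by rw [ha n hn, smul_zero])

theorem idealI_le_orderGE : idealI K N ≤ orderGE K N 1 := by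
  intro v hv n hn
  obtain rfl : n = 0 := by omega
  rw [coeff_zero_eq_constantCoeff_apply, constantCoeff_toSeries,
    show algToMu K N v = 0 from hv, map_zero]

theorem idealI_pow_le_orderGE (m : ℕ) : idealI K N ^ (m + 1) ≤ orderGE K N (m + 1) := by
  induction m with
  | zero =>
    rw [pow_one]
    exact idealI_le_orderGE K N
  | succ m ih =>
    rw [pow_succ]
    refine Submodule.mul_le.2 fun a ha b hb => ?_
    intro n hn
    rw [map_mul]
    exact coeff_mul_eq_zero_of_vanish (ih ha) (idealI_le_orderGE K N hb) n hn

theorem coeff_toSeries_of_mem {n : ℕ} {m : ℤ} (h : (n : ℤ) < m) {v : VB K}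
    (hv : v ∈ (filtVB K N).F m) : coeff n (toSeries K N v) = 0 := by
  obtain ⟨k, rfl⟩ : ∃ k : ℕ, m = (k + 1 : ℕ) := ⟨m.toNat - 1, by omega⟩
  rw [filtVB_natCast_succ] at hv
  exact idealI_pow_le_orderGE K N k hv n (by omega)

/-- The coefficient of degree `m` of the expansion of an element of `K F₂`; it is zero if
`m < 0`. -/
noncomputable def leadV (m : ℤ) : VB K →ₗ[K] VDR K N :=
  if 0 ≤ m then
    { toFun := fun v => coeff m.toNat (toSeries K N v)
      map_add' := fun a b => by rw [map_add, map_add]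
      map_smul' := fun c a => by rw [map_smul]; exact coeff_smul _ _ c }
  else 0

theorem leadV_natCast (m : ℕ) (v : VB K) : leadV K N m v = coeff m (toSeries K N v) := by
  rw [leadV, if_pos (by positivity)]
  rfl

theorem leadV_of_neg {m : ℤ} (hm : m < 0) (v : VB K) : leadV K N m v = 0 := by
  rw [leadV, if_neg (by omega)]
  rfl

theorem leadV_eq_zero {m n : ℤ} (h : m < n) {v : VB K} (hv : v ∈ (filtVB K N).F n) :
    leadV K N m v = 0 := by
  rcases lt_or_ge m 0 with hm | hm
  · exact leadV_of_neg K N hm v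
  · lift m to ℕ using hm
    rw [leadV_natCast]
    exact coeff_toSeries_of_mem K N h hv

theorem leadV_mul {i j : ℤ} {a b : VB K} (ha : a ∈ (filtVB K N).F i) (hb : b ∈ (filtVB K N).F j) :
    leadV K N (i + j) (a * b) = leadV K N i a * leadV K N j b := by
  rcases lt_or_ge i 0 with hi | hi
  -- For i < 0 the element a still lies in F^0, so ab lies in F^j with j > i + j, and the left side
  -- vanishes too.
  · rw [leadV_of_neg K N hi, zero_mul]
    refine leadV_eq_zero K N (n := 0 + j) (by omega) ?_
    exact (filtVB K N).mul_mem (filtVB_zero K N a) hb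
  rcases lt_or_ge j 0 with hj | hj
  · rw [leadV_of_neg K N hj, mul_zero]
    refine leadV_eq_zero K N (n := i + 0) (by omega) ?_
    exact (filtVB K N).mul_mem ha (filtVB_zero K N b)
  lift i to ℕ using hi
  lift j to ℕ using hj
  rw [← Nat.cast_add, leadV_natCast, leadV_natCast, leadV_natCast, map_mul]
  exact coeff_add_mul_of_vanish (fun n hn => coeff_toSeries_of_mem K N (by omega) ha)
    (fun n hn => coeff_toSeries_of_mem K N (by omega) hb)

/-- The map `gr(V^B_N) → V^DR_N` given by the leading coefficients of the expansions. -/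
noncomputable def sigmaV : (filtVB K N).Gr →ₗ[K] VDR K N :=
  AlgFiltration.grLift (leadV K N) fun i _ ha => leadV_eq_zero K N (by omega : i < i + 1) ha

theorem sigmaV_cls {i : ℤ} {a : VB K} (ha : a ∈ (filtVB K N).F i) :
    sigmaV K N ((filtVB K N).cls i a ha) = leadV K N i a :=
  AlgFiltration.grLift_cls _ _ ha

theorem sigmaV_mul (x y : (filtVB K N).Gr) :
    sigmaV K N (x * y) = sigmaV K N x * sigmaV K N y := by
  induction x using AlgFiltration.gr_induction with
  | h0 => simp
  | hadd x x' hx hx' => rw [add_mul, map_add, hx, hx', map_add, add_mul]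
  | hcls i a ha =>
    induction y using AlgFiltration.gr_induction with
    | h0 => simp
    | hadd y y' hy hy' => rw [mul_add, map_add, hy, hy', map_add, mul_add]
    | hcls j b hb =>
      rw [AlgFiltration.cls_mul, sigmaV_cls, sigmaV_cls, sigmaV_cls, leadV_mul K N ha hb]

theorem leadV_zero_bX (n : ℤ) : leadV K N 0 (bX K 0 n) = drι K N (.root (zetaN N ^ n)) := by
  have h := leadV_natCast K N 0 (bX K 0 n)
  rw [Nat.cast_zero] at h
  rw [h, coeff_zero_eq_constantCoeff_apply, constantCoeff_toSeries]
  simp [algToMu, bX, toMu, rootUnit]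

theorem sigmaV_one : sigmaV K N 1 = 1 := by
  rw [← AlgFiltration.cls_one, sigmaV_cls, ← bX_zero K 0, leadV_zero_bX, zpow_zero, drι_one]

/-- As ζ_N commutes with e₀, each of the n factors contributes the same linear term. For n = N the
factor N cancels 1/N and ζ_N^N = 1, leaving e₀; the ℚ-algebra structure enters through this inverse.
-/
theorem coeff_one_pow_serX0 (n : ℕ) : coeff 1 (serX0 K N ^ n) =
    n • (algebraMap ℚ K (N : ℚ)⁻¹ • (drι K N (.root (zetaN N ^ n)) * drι K N .e0)) := by
  have h0 : ∀ n : ℕ, constantCoeff (serX0 K N ^ n) = drι K N (.root (zetaN N ^ n)) := by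
    intro n
    rw [map_pow, constantCoeff_serX0, ← Units.val_pow_eq_pow_val, ← map_pow]
    rfl
  induction n with
  | zero => simp
  | succ n ih =>
    have h1 : coeff 1 (serX0 K N) =
        algebraMap ℚ K (N : ℚ)⁻¹ • (drι K N (.root (zetaN N)) * drι K N .e0) := by
      simp [serX0, coeff_succ_mul_X, coeff_C]
    have h2 : constantCoeff (serX0 K N) = drι K N (.root (zetaN N)) := constantCoeff_serX0 K N
    have h3 : ∀ f g : (VDR K N)⟦X⟧, coeff 1 (f * g) =
        constantCoeff f * coeff 1 g + coeff 1 f * constantCoeff g := by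
      intro f g
      simp [coeff_mul, Finset.Nat.antidiagonal_succ]
    rw [pow_succ, h3, h0, h1, h2, ih, mul_smul_comm, ← mul_assoc, drι_mul, ← pow_succ,
      smul_mul_assoc, smul_mul_assoc, mul_assoc, ← drι_comm, ← mul_assoc, drι_mul, ← pow_succ,
      succ_nsmul']

theorem leadV_e0 : leadV K N 1 (bX K 0 N - 1) = drι K N .e0 := by
  have h := leadV_natCast K N 1 (bX K 0 N - 1)
  rw [Nat.cast_one] at h
  have h2 : bX K 0 N = bX K 0 1 ^ N := by
    simp [bX]
  rw [h, map_sub, map_one, h2, map_pow, toSeries_bX_zero, map_sub, coeff_one_pow_serX0, zetaN_pow,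
    drι_one, one_mul, ← Nat.cast_smul_eq_nsmul K, smul_smul, ← map_natCast (algebraMap ℚ K),
    ← map_mul, mul_inv_cancel₀ (Nat.cast_ne_zero.2 (NeZero.ne N)), map_one, one_smul]
  simp [coeff_one]

theorem leadV_e1 : leadV K N 1 (bX K 1 1 - 1) = drι K N .e1 := by
  have h := leadV_natCast K N 1 (bX K 1 1 - 1)
  rw [Nat.cast_one] at h
  rw [h, map_sub, map_one, toSeries_bX_one, serX1, add_sub_cancel_left]
  simp [coeff_succ_mul_X]

/-- Since `sigmaV` is multiplicative, the composite is an algebra morphism, and it fixes e₀, e₁ and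
the roots of unity. -/
theorem sigmaV_rhoV (v : VDR K N) : sigmaV K N (rhoV K N v) = v := by
  let E : Subalgebra K (VDR K N) :=
    AlgHom.equalizer (((AlgHom.ofLinearMap (sigmaV K N) (sigmaV_one K N) (sigmaV_mul K N)).comp
      (rhoV K N))) (AlgHom.id K _)
  refine VDR_mem_of_gen E ?_ v
  rintro (_ | _ | ζ)
  · change sigmaV K N (rhoV K N (drι K N _)) = drι K N _
    rw [rhoV_e0, sigmaV_cls, leadV_e0]
  · change sigmaV K N (rhoV K N (drι K N _)) = drι K N _
    rw [rhoV_e1, sigmaV_cls, leadV_e1]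
  · obtain ⟨n, rfl⟩ := mem_zpowers_zetaN N ζ
    change sigmaV K N (rhoV K N (drι K N _)) = drι K N _
    rw [rhoV_root, sigmaV_cls, leadV_zero_bX]

theorem rhoV_bijective : Function.Bijective (rhoV K N) :=
  ⟨Function.LeftInverse.injective (sigmaV_rhoV K N), rhoV_surjective K N⟩

end RhoInjective

/-! ### The morphism `ρ^W_N` is a graded isomorphism -/

section RhoW

variable (K : Type*) [CommRing K] (N : ℕ) [NeZero N]

theorem mem_filtWB {i : ℤ} {w : WB K} : w ∈ (filtWB K N).F i ↔ (w : VB K) ∈ (filtVB K N).F i :=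
  Iff.rfl

theorem grIncl_cls {i : ℤ} {w : WB K} (hw : w ∈ (filtWB K N).F i) :
    grIncl K N ((filtWB K N).cls i w hw) =
      (filtVB K N).cls i (w : VB K) ((mem_filtWB K N).1 hw) :=
  AlgFiltration.grMap_cls _ _ _

/-- In K μ_N the term v(X₁ - 1) dies, while c remains as the coefficient of 1. -/
theorem algebraMap_add_mem_idealI {c : K} {v : VB K}
    (h : algebraMap K (VB K) c + v * (bX K 1 1 - 1) ∈ idealI K N) : c = 0 := by
  have h1 : algToMu K N (bX K 1 1 - 1) = 0 := bX_one_one_sub_one_mem K N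
  have h2 : algToMu K N (algebraMap K (VB K) c + v * (bX K 1 1 - 1)) = 0 := h
  rw [map_add, map_mul, h1, mul_zero, add_zero, AlgHom.commutes] at h2
  have h3 := congrArg (fun x : MonoidAlgebra K (rootsOfUnity N ℂ) => x.coeff 1) h2
  simpa using h3

/-- The homogeneous elements of degree `n` of `V^DR_N` have image in degree `n`. -/
theorem rhoV_mem_range_lof {n : ℕ} {v : VDR K N} (hv : v ∈ degVDR K N n) :
    rhoV K N v ∈ LinearMap.range (DirectSum.lof K ℤ (filtVB K N).Piece n) := by
  have hgen : ∀ g : DRGen N, ∃ (a : VB K) (ha : a ∈ (filtVB K N).F g.deg),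
      rhoV K N (drι K N g) = (filtVB K N).cls g.deg a ha := by
    rintro (_ | _ | ζ)
    · exact ⟨_, _, rhoV_e0 K N⟩
    · exact ⟨_, _, rhoV_e1 K N⟩
    · obtain ⟨m, rfl⟩ := mem_zpowers_zetaN N ζ
      exact ⟨_, _, rhoV_root K N m⟩
  have hword : ∀ l : List (DRGen N), ∃ (a : VB K) (ha : a ∈ (filtVB K N).F (l.map DRGen.deg).sum),
      rhoV K N (l.map (drι K N)).prod = (filtVB K N).cls (l.map DRGen.deg).sum a ha := by
    intro l
    induction l with
    | nil => exact ⟨1, (filtVB K N).one_mem, map_one _⟩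
    | cons g l ih =>
      obtain ⟨a, ha, ha'⟩ := hgen g
      obtain ⟨b, hb, hb'⟩ := ih
      have h := (filtVB K N).mul_mem ha hb
      rw [← Nat.cast_add] at h
      refine ⟨a * b, by simpa using h, ?_⟩
      rw [List.map_cons, List.prod_cons, map_mul, ha', hb', AlgFiltration.cls_mul]
      exact AlgFiltration.cls_congr _ (by simp) rfl _ _
  refine Submodule.span_induction (p := fun v _ => rhoV K N v ∈ LinearMap.range _) ?_ ?_ ?_ ?_ hv
  · rintro _ ⟨l, rfl, rfl⟩
    obtain ⟨a, ha, h⟩ := hword l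
    rw [h]
    exact ⟨_, rfl⟩
  · rw [map_zero]
    exact Submodule.zero_mem _
  · intro a b _ _ ha hb
    rw [map_add]
    exact Submodule.add_mem _ ha hb
  · intro c a _ ha
    rw [map_smul]
    exact Submodule.smul_mem _ c ha

/-- The inclusion gr(W^B) → gr(V^B) commutes with projection to degree n. By injectivity, x agrees
with its own component of degree n. -/
theorem mem_range_lof_of_grIncl {n : ℤ} {x : (filtWB K N).Gr}
    (h : grIncl K N x ∈ LinearMap.range (DirectSum.lof K ℤ (filtVB K N).Piece n)) :
    x ∈ LinearMap.range (DirectSum.lof K ℤ (filtWB K N).Piece n) := by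
  have key : ∀ x : (filtWB K N).Gr, grIncl K N (DirectSum.lof K ℤ _ n (x n)) =
      DirectSum.lof K ℤ _ n (grIncl K N x n) := by
    intro x
    induction x using AlgFiltration.gr_induction with
    | h0 => simp
    | hadd x y hx hy => simp only [map_add, DirectSum.add_apply, hx, hy]
    | hcls i a ha =>
      rw [grIncl_cls]
      unfold AlgFiltration.cls
      rw [DirectSum.lof_eq_of, DirectSum.lof_eq_of, DirectSum.lof_eq_of, DirectSum.lof_eq_of]
      by_cases hi : i = n
      · subst hi
        rw [DirectSum.of_eq_same, DirectSum.of_eq_same]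
        exact grIncl_cls K N ha
      · rw [DirectSum.of_eq_of_ne _ _ _ (Ne.symm hi), DirectSum.of_eq_of_ne _ _ _ (Ne.symm hi),
          map_zero, map_zero, map_zero]
  obtain ⟨y, hy⟩ := h
  refine ⟨x n, grIncl_injective K N ?_⟩
  rw [key, ← hy, DirectSum.lof_eq_of, DirectSum.lof_eq_of, DirectSum.of_eq_same]

theorem rhoW_mem_range_lof {n : ℕ} {w : WDR K N} (hw : (w : VDR K N) ∈ degVDR K N n) :
    rhoW K N w ∈ LinearMap.range (DirectSum.lof K ℤ (filtWB K N).Piece n) := by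
  apply mem_range_lof_of_grIncl
  rw [grIncl_rhoW]
  exact rhoV_mem_range_lof K N hw

variable [Algebra ℚ K]

theorem rhoW_injective : Function.Injective (rhoW K N) := by
  intro a b h
  have h1 := congrArg (grIncl K N) h
  rw [grIncl_rhoW, grIncl_rhoW] at h1
  exact Subtype.ext ((rhoV_bijective K N).1 h1)

/-- Right multiplication by `X₁ - 1` is strict with respect to the filtration. -/
theorem mem_filtVB_of_mul_mem {i : ℤ} {v : VB K}
    (h : v * (bX K 1 1 - 1) ∈ (filtVB K N).F (i + 1)) : v ∈ (filtVB K N).F i := by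
  -- As k + 2 ≤ i + 1, the product [v]_k [X₁ - 1]_1 is zero. Writing [v]_k as ρ^V(u), injectivity of
  -- ρ^V gives u e₁ = 0, hence u = 0, so v moves up one step.
  have step : ∀ k : ℤ, k < i → v ∈ (filtVB K N).F k → v ∈ (filtVB K N).F (k + 1) := by
    intro k hk hv
    have hx := mem_filtVB_one K N (bX_one_one_sub_one_mem K N)
    have h0 : (filtVB K N).cls k v hv * (filtVB K N).cls 1 _ hx = 0 := by
      rw [AlgFiltration.cls_mul]
      exact AlgFiltration.cls_eq_zero _ _ ((filtVB K N).anti (by omega) h)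
    obtain ⟨u, hu⟩ := rhoV_surjective K N ((filtVB K N).cls k v hv)
    rw [← rhoV_e1, ← hu, ← map_mul, map_eq_zero_iff _ (rhoV_bijective K N).1] at h0
    rw [← AlgFiltration.cls_eq_zero_iff _ hv, ← hu, mul_e1_injective K N h0, map_zero]
  rcases le_or_gt i 0 with hi | hi
  · exact filtVB_of_nonpos K N hi v
  · refine Int.leInduction (m := 0) (motive := fun k _ => k ≤ i → v ∈ (filtVB K N).F k)
      (fun _ => filtVB_zero K N v) (fun k _ ih hk' => step k (by omega) (ih (by omega))) i
      hi.le le_rfl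

/-- An element of positive filtration lies in I_N, so its scalar part vanishes; strictness then
controls the cofactor of X₁ - 1. -/
theorem filtWB_eq_mul {i : ℤ} (hi : 0 < i) {w : WB K} (hw : w ∈ (filtWB K N).F i) :
    ∃ v ∈ (filtVB K N).F (i - 1), (w : VB K) = v * (bX K 1 1 - 1) := by
  obtain ⟨_, c, v, rfl⟩ := w
  have hw' : algebraMap K (VB K) c + v * (bX K 1 1 - 1) ∈ (filtVB K N).F i := hw
  have hc : c = 0 := algebraMap_add_mem_idealI K N
    ((mem_filtVB_one_iff K N).1 ((filtVB K N).anti (by omega) hw'))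
  rw [hc, map_zero, zero_add] at hw'
  refine ⟨v, mem_filtVB_of_mul_mem K N (by rwa [sub_add_cancel]), ?_⟩
  change algebraMap K (VB K) c + v * (bX K 1 1 - 1) = _
  rw [hc, map_zero, zero_add]

theorem rhoW_surjective : Function.Surjective (rhoW K N) := by
  intro x
  change x ∈ (rhoW K N).range
  induction x using AlgFiltration.gr_induction with
  | h0 => exact Subalgebra.zero_mem _
  | hadd x y hx hy => exact Subalgebra.add_mem _ hx hy
  | hcls i w hw =>
    have hx := mem_filtVB_one K N (bX_one_one_sub_one_mem K N)
    rcases lt_trichotomy i 0 with hi | rfl | hi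
    · rw [AlgFiltration.cls_eq_zero _ hw]
      · exact Subalgebra.zero_mem _
      · exact filtVB_of_nonpos K N (by omega) (w : VB K)
    · obtain ⟨_, c, v, rfl⟩ := w
      have h1 : (filtWB K N).cls 0 _ hw = (filtWB K N).cls 0 (algebraMap K (WB K) c)
          ((mem_filtWB K N).2 (filtVB_zero K N _)) := by
        -- In degree 0 the part v(X₁ - 1) is negligible, being in F^1, so only scalars remain.
        refine AlgFiltration.cls_sub_eq _ _ _ ?_
        change algebraMap K (VB K) c + v * (bX K 1 1 - 1) - algebraMap K (VB K) c ∈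
          (filtVB K N).F (0 + 1)
        rw [add_sub_cancel_left]
        exact (filtVB K N).mul_mem (filtVB_zero K N v) hx
      rw [h1, AlgFiltration.cls_algebraMap]
      exact Subalgebra.algebraMap_mem _ c
    · obtain ⟨v, hv, h⟩ := filtWB_eq_mul K N hi hw
      obtain ⟨u, hu⟩ := rhoV_surjective K N ((filtVB K N).cls _ v hv)
      refine ⟨⟨u * drι K N .e1, mul_mem_leftSub _ _⟩, grIncl_injective K N ?_⟩
      change grIncl K N (rhoW K N _) = _
      rw [grIncl_rhoW, grIncl_cls]
      change rhoV K N (u * drι K N .e1) = _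
      rw [map_mul, hu, rhoV_e1, AlgFiltration.cls_mul]
      exact AlgFiltration.cls_congr _ (by omega) h.symm _ _

theorem rhoW_bijective : Function.Bijective (rhoW K N) :=
  ⟨rhoW_injective K N, rhoW_surjective K N⟩

end RhoW

/-! ### The associated graded of a tensor product -/

namespace AlgFiltration

section GrTensor

variable {K A B : Type*} [CommRing K] [Ring A] [Algebra K A] [Ring B] [Algebra K B]
  {𝓕 : AlgFiltration K A} {𝓖 : AlgFiltration K B}

theorem tensor_le {m : ℤ} {P : Submodule K (A ⊗[K] B)}
    (h : ∀ i j, i + j = m → ∀ a ∈ 𝓕.F i, ∀ b ∈ 𝓖.F j, a ⊗ₜ[K] b ∈ P) :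
    (𝓕.tensor 𝓖).F m ≤ P :=
  iSup_le fun i => iSup_le fun j => iSup_le fun hij =>
    Submodule.map₂_le.2 fun a ha b hb => h i j hij a ha b hb

theorem grTensor_surjective : Function.Surjective (grTensor 𝓕 𝓖) := by
  intro x
  change x ∈ (grTensor 𝓕 𝓖).range
  induction x using gr_induction with
  | h0 => exact Subalgebra.zero_mem _
  | hadd x y hx hy => exact Subalgebra.add_mem _ hx hy
  | hcls m x hx =>
    suffices h : x ∈ (𝓕.tensor 𝓖).clsPreimage (grTensor 𝓕 𝓖).range m from h.2
    refine tensor_le ?_ hx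
    rintro i j rfl a ha b hb
    exact ⟨tmul_mem_tensor rfl ha hb, _, grTensor_cls_tmul_cls ha hb⟩

theorem hasCls_tmul {i j m : ℤ} (h : i + j = m) {a : A} {b : B} (ha : a ∈ 𝓕.F i)
    (hb : b ∈ 𝓖.F j) : (𝓕.tensor 𝓖).HasCls m (a ⊗ₜ b)
      (grTensor 𝓕 𝓖 (𝓕.cls i a ha ⊗ₜ 𝓖.cls j b hb)) := by
  subst h
  exact ⟨tmul_mem_tensor rfl ha hb, (grTensor_cls_tmul_cls ha hb).symm⟩

variable {C D : Type*} [AddCommGroup C] [Module K C] [AddCommGroup D] [Module K D]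
  (c : ℤ → A →ₗ[K] C) (d : ℤ → B →ₗ[K] D)

/-- The convolution `∑_{p + q = m, p, q ≥ 0} c_p ⊗ d_q`. -/
noncomputable def convTensor (m : ℤ) : A ⊗[K] B →ₗ[K] C ⊗[K] D :=
  ∑ p ∈ Finset.Icc 0 m, TensorProduct.map (c p) (d (m - p))

variable {c d}

/-- In the convolution, c_p kills a when p < i, and d_(i+j-p) kills b when p > i. Only p = i
survives. -/
theorem convTensor_tmul (hc : ∀ {i j : ℤ}, i < j → ∀ a ∈ 𝓕.F j, c i a = 0)
    (hd : ∀ {i j : ℤ}, i < j → ∀ b ∈ 𝓖.F j, d i b = 0)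
    (hc' : ∀ i < 0, c i = 0) (hd' : ∀ i < 0, d i = 0) {i j : ℤ} {a : A} {b : B}
    (ha : a ∈ 𝓕.F i) (hb : b ∈ 𝓖.F j) : convTensor c d (i + j) (a ⊗ₜ b) = c i a ⊗ₜ d j b := by
  simp only [convTensor, LinearMap.sum_apply, TensorProduct.map_tmul]
  rw [Finset.sum_eq_single i, add_sub_cancel_left]
  · intro p _ hp
    rcases lt_or_gt_of_ne hp with h | h
    · rw [hc h a ha, TensorProduct.zero_tmul]
    · rw [hd (by omega : i + j - p < j) b hb, TensorProduct.tmul_zero]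
  -- If i is outside [0, i + j], then i or j is negative, and the expected value is zero because c
  -- or d vanishes in negative degrees.
  · intro h
    rw [add_sub_cancel_left]
    rcases lt_or_ge i 0 with hi | hi
    · rw [hc' i hi, LinearMap.zero_apply, TensorProduct.zero_tmul]
    · rw [hd' j (by rw [Finset.mem_Icc] at h; omega), LinearMap.zero_apply,
        TensorProduct.tmul_zero]

theorem convTensor_eq_zero (hc : ∀ {i j : ℤ}, i < j → ∀ a ∈ 𝓕.F j, c i a = 0)
    (hd : ∀ {i j : ℤ}, i < j → ∀ b ∈ 𝓖.F j, d i b = 0) (m : ℤ) (x : A ⊗[K] B)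
    (hx : x ∈ (𝓕.tensor 𝓖).F (m + 1)) : convTensor c d m x = 0 := by
  suffices h : (𝓕.tensor 𝓖).F (m + 1) ≤ LinearMap.ker (convTensor c d m) from h hx
  refine tensor_le fun i j hij a ha b hb => ?_
  rw [LinearMap.mem_ker]
  simp only [convTensor, LinearMap.sum_apply, TensorProduct.map_tmul]
  refine Finset.sum_eq_zero fun p _ => ?_
  rcases lt_or_ge p i with h | h
  · rw [hc h a ha, TensorProduct.zero_tmul]
  · rw [hd (by omega : m - p < j) b hb, TensorProduct.tmul_zero]

/-- The morphism `gr(A) ⊗ gr(B) → gr(A ⊗ B)` is bijective when `gr(A)` and `gr(B)` are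
detected by linear maps defined on the whole of `A` and `B`. -/
theorem grTensor_bijective (hc : ∀ {i j : ℤ}, i < j → ∀ a ∈ 𝓕.F j, c i a = 0)
    (hd : ∀ {i j : ℤ}, i < j → ∀ b ∈ 𝓖.F j, d i b = 0)
    (hc' : ∀ i < 0, c i = 0) (hd' : ∀ i < 0, d i = 0)
    (hcb : Function.Bijective (grLift (𝓕 := 𝓕) c fun _ a ha => hc (lt_add_one _) a ha))
    (hdb : Function.Bijective (grLift (𝓕 := 𝓖) d fun _ b hb => hd (lt_add_one _) b hb)) :
    Function.Bijective (grTensor 𝓕 𝓖) := by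
  refine ⟨?_, grTensor_surjective⟩
  let e := TensorProduct.congr (LinearEquiv.ofBijective _ hcb) (LinearEquiv.ofBijective _ hdb)
  let s : (𝓕.tensor 𝓖).Gr →ₗ[K] C ⊗[K] D :=
    grLift (convTensor c d) (convTensor_eq_zero hc hd)
  -- Here e is a tensor product of isomorphisms, hence bijective, so this identity gives injectivity
  -- without any flatness.
  have h : ∀ z, s (grTensor 𝓕 𝓖 z) = e z := by
    intro z
    induction z using TensorProduct.induction_on with
    | zero => simp
    | add z z' hz hz' => rw [map_add, map_add, hz, hz', map_add]
    | tmul x y =>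
      induction x using gr_induction with
      | h0 => simp
      | hadd x x' hx hx' => simp only [TensorProduct.add_tmul, map_add, hx, hx']
      | hcls i a ha =>
        induction y using gr_induction with
        | h0 => simp
        | hadd y y' hy hy' => simp only [TensorProduct.tmul_add, map_add, hy, hy']
        | hcls j b hb =>
          rw [grTensor_cls_tmul_cls, grLift_cls, convTensor_tmul hc hd hc' hd' ha hb]
          simp only [e, TensorProduct.congr_tmul, LinearEquiv.ofBijective_apply, grLift_cls]
  intro z z' hzz
  apply e.injective
  rw [← h, ← h, hzz]

end GrTensor

end AlgFiltration

/-! ### Leading terms on `W^B_N` and the graded algebra of its tensor square -/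

section GrTensorWB

variable (K : Type*) [CommRing K] [Algebra ℚ K] (N : ℕ) [NeZero N]

/-- The leading coefficients of the expansions of the elements of `W^B_N`, projected to
`W^DR_N`. -/
noncomputable def leadW (m : ℤ) : WB K →ₗ[K] WDR K N :=
  retractDR K N ∘ₗ leadV K N m ∘ₗ (WB K).val.toLinearMap

theorem leadW_eq_zero {i j : ℤ} (h : i < j) (w : WB K) (hw : w ∈ (filtWB K N).F j) :
    leadW K N i w = 0 := by
  change retractDR K N (leadV K N i (w : VB K)) = 0
  rw [leadV_eq_zero K N h ((mem_filtWB K N).1 hw), map_zero]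

theorem leadW_of_neg (i : ℤ) (hi : i < 0) : leadW K N i = 0 := by
  ext w : 1
  change retractDR K N (leadV K N i (w : VB K)) = 0
  rw [leadV_of_neg K N hi, map_zero]

/-- The map induced by `leadW` is a left inverse of ρ^W, thanks to `sigmaV_rhoV` and the retraction;
since ρ^W is already bijective, it is the inverse. -/
theorem grLift_leadW_bijective : Function.Bijective (AlgFiltration.grLift (𝓕 := filtWB K N)
    (leadW K N) fun _ w hw => leadW_eq_zero K N (lt_add_one _) w hw) := by
  set s := AlgFiltration.grLift (𝓕 := filtWB K N)
    (leadW K N) fun _ w hw => leadW_eq_zero K N (lt_add_one _) w hw with hs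
  have h1 : ∀ x, s x = retractDR K N (sigmaV K N (grIncl K N x)) := by
    intro x
    induction x using AlgFiltration.gr_induction with
    | h0 => simp
    | hadd x y hx hy => simp only [map_add, hx, hy]
    | hcls i w hw =>
      rw [grIncl_cls, sigmaV_cls, hs, AlgFiltration.grLift_cls]
      rfl
  have h2 : ∀ w, s (rhoW K N w) = w := by
    intro w
    rw [h1, grIncl_rhoW, sigmaV_rhoV, retractDR_coe]
  have h3 : Function.Bijective (s ∘ rhoW K N) := by
    rw [show s ∘ rhoW K N = id from funext h2]
    exact Function.bijective_id
  exact (Function.Bijective.of_comp_iff _ (rhoW_bijective K N)).1 h3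

theorem grTensor_filtWB_bijective :
    Function.Bijective (AlgFiltration.grTensor (filtWB K N) (filtWB K N)) :=
  AlgFiltration.grTensor_bijective (fun h => leadW_eq_zero K N h) (fun h => leadW_eq_zero K N h)
    (leadW_of_neg K N) (leadW_of_neg K N) (grLift_leadW_bijective K N)
    (grLift_leadW_bijective K N)

end GrTensorWB

/-! ### The Betti coproduct on the elements `(X₀^N - 1)^m X₀^a (X₁ - 1)` -/

section MixedSum

/-- The sign convention for reversed bounds is what makes this recursion valid for every integer q,
and so allows negative exponents of X₀ throughout. -/
theorem intSum_one_succ {M : Type*} [AddCommGroup M] (q : ℤ) (f : ℤ → M) :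
    intSum 1 (q + 1) f = intSum 1 q f + f (q + 1) := by
  unfold intSum
  rcases lt_trichotomy q (-1) with h | rfl | h
  · rw [if_neg (by omega), if_neg (by omega),
      show Finset.Icc (q + 1) (1 - 1) = insert (q + 1) (Finset.Icc (q + 1 + 1) (1 - 1)) by
        ext; simp; omega, Finset.sum_insert (by simp)]
    abel
  · simp
  · rw [if_pos (by omega), if_pos (by omega),
      show Finset.Icc 1 (q + 1) = insert (q + 1) (Finset.Icc 1 q) by ext; simp; omega,
      Finset.sum_insert (by simp), add_comm]

theorem map_intSum {M M' F : Type*} [AddCommGroup M] [AddCommGroup M'] [FunLike F M M']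
    [AddMonoidHomClass F M M'] (φ : F) (p q : ℤ) (f : ℤ → M) :
    φ (intSum p q f) = intSum p q fun k => φ (f k) := by
  unfold intSum
  split_ifs <;> simp

variable {R : Type*} [CommRing R] {x y : ℤ → R}

/-- The sum `∑_{k=1}^{n-1} x_k y_{n-k}`. -/
noncomputable def mixedSum (x y : ℤ → R) (n : ℤ) : R := intSum 1 (n - 1) fun k => x k * y (n - k)

theorem mixedSum_succ (hy : ∀ m n, y (m + n) = y m * y n) (n : ℤ) :
    mixedSum x y (n + 1) = y 1 * mixedSum x y n + x n * y 1 := by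
  unfold mixedSum
  have h : ∀ (p q : ℤ) (f : ℤ → R), y 1 * intSum p q f = intSum p q fun k => y 1 * f k :=
    map_intSum (AddMonoidHom.mulLeft (y 1))
  rw [show n + 1 - 1 = n - 1 + 1 by ring, intSum_one_succ, h, sub_add_cancel, add_sub_cancel_left]
  congr 2
  funext k
  rw [show n + 1 - k = 1 + (n - k) by ring, hy]
  ring

theorem mixedSum_add_nat (hx : ∀ m n, x (m + n) = x m * x n) (hy : ∀ m n, y (m + n) = y m * y n)
    (hy0 : y 0 = 1) (n : ℤ) (k : ℕ) :
    mixedSum x y (n + k) =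
      y k * mixedSum x y n + x n * ∑ j ∈ Finset.range k, x j * y (k - j) := by
  induction k with
  | zero => simp [hy0]
  | succ k ih =>
    have h : ∀ j : ℕ, y ((k + 1 : ℕ) - j) = y 1 * y (k - j) := by
      intro j
      rw [← hy]
      congr 1
      push_cast
      ring
    rw [Nat.cast_succ, ← add_assoc, mixedSum_succ hy, ih, hx, ← Nat.cast_succ]
    simp only [h, Finset.sum_range_succ, sub_self, hy0]
    simp only [mul_left_comm _ (y 1), ← Finset.mul_sum]
    rw [Nat.cast_succ, add_comm (k : ℤ) 1, hy]
    ring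

/-- The closed form of the `m`-th iterated difference, with step `N`, of `mixedSum`. -/
noncomputable def mixedDiff (x y : ℤ → R) (N m : ℕ) (a : ℤ) : R :=
  (y N - 1) ^ m * mixedSum x y a + x a * (∑ j ∈ Finset.range N, x j * y (N - j)) *
    ∑ i ∈ Finset.range m, (x N - 1) ^ i * (y N - 1) ^ (m - 1 - i)

theorem mixedDiff_zero (N : ℕ) (a : ℤ) : mixedDiff x y N 0 a = mixedSum x y a := by
  simp [mixedDiff]

/-- Let S be the mixed sum and C = ∑_{j<N} x_j y_(N-j). A shift by N sends S(a) to y_N S(a) + x_a C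
and x_a to x_N x_a. The difference operator is therefore triangular with diagonal entries y_N - 1
and x_N - 1, and its powers involve the complete homogeneous polynomials h_(m-1) in these two, which
satisfy h_m(s, t) = t^m + s h_(m-1)(s, t). -/
theorem mixedDiff_succ (hx : ∀ m n, x (m + n) = x m * x n) (hy : ∀ m n, y (m + n) = y m * y n)
    (hy0 : y 0 = 1) (N m : ℕ) (a : ℤ) :
    mixedDiff x y N (m + 1) a = mixedDiff x y N m (a + N) - mixedDiff x y N m a := by
  have h : ∑ i ∈ Finset.range (m + 1), (x N - 1) ^ i * (y N - 1) ^ (m + 1 - 1 - i) =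
      (y N - 1) ^ m + (x N - 1) *
        ∑ i ∈ Finset.range m, (x N - 1) ^ i * (y N - 1) ^ (m - 1 - i) := by
    rw [Finset.sum_range_succ', Finset.mul_sum, add_comm]
    congr 1
    · simp
    · refine Finset.sum_congr rfl fun i _ => ?_
      rw [show m + 1 - 1 - (i + 1) = m - 1 - i by omega]
      ring
  unfold mixedDiff
  rw [h, mixedSum_add_nat hx hy hy0, hx]
  ring

end MixedSum

/-! ### The Betti coproduct expressed through Laurent polynomials in X₀ -/

section BettiCoproduct

open LaurentPolynomial

variable (K : Type*) [CommRing K]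

/-- The evaluation at `X₀` of Laurent polynomials. -/
noncomputable def evalX0 : LaurentPolynomial K →ₐ[K] VB K :=
  AddMonoidAlgebra.lift K _ _
    { toFun := fun n => bX K 0 n.toAdd
      map_one' := bX_zero K 0
      map_mul' := fun m n => bX_add K 0 m.toAdd n.toAdd }

theorem evalX0_T (n : ℤ) : evalX0 K (T n) = bX K 0 n := by
  exact (AddMonoidAlgebra.lift_single _ _ _).trans (one_smul _ _)

/-- The map `p ↦ p(X₀) (X₁ - 1)`. -/
noncomputable def lauY : LaurentPolynomial K →ₗ[K] WB K where
  toFun p := ⟨evalX0 K p * (bX K 1 1 - 1), mul_mem_leftSub _ _⟩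
  map_add' p q := Subtype.ext (by simp [add_mul])
  map_smul' c p := Subtype.ext (by simp)

theorem lauY_T (n : ℤ) : lauY K (T n) = wY K n :=
  Subtype.ext (congrArg (· * (bX K 1 1 - 1)) (evalX0_T K n))

theorem deltaB_spec : IsBettiCoproduct K (deltaB K) :=
  (existsUnique_isBettiCoproduct K).choose_spec.1

/-- The element `X^n ⊗ 1`. -/
noncomputable def lauLeft (n : ℤ) : LaurentPolynomial K ⊗[K] LaurentPolynomial K := T n ⊗ₜ 1

/-- The element `1 ⊗ X^n`. -/
noncomputable def lauRight (n : ℤ) : LaurentPolynomial K ⊗[K] LaurentPolynomial K := 1 ⊗ₜ T n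

theorem lauLeft_add (m n : ℤ) : lauLeft K (m + n) = lauLeft K m * lauLeft K n := by
  rw [lauLeft, T_add, lauLeft, lauLeft, Algebra.TensorProduct.tmul_mul_tmul, mul_one]

theorem lauRight_add (m n : ℤ) : lauRight K (m + n) = lauRight K m * lauRight K n := by
  rw [lauRight, T_add, lauRight, lauRight, Algebra.TensorProduct.tmul_mul_tmul, mul_one]

theorem lauRight_zero : lauRight K 0 = 1 := by
  simp [lauRight, Algebra.TensorProduct.one_def]

/-- The quadratic term comes from the commutative ring of Laurent polynomials in two variables,
where the differences of `mixedSum` can be computed. -/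
theorem deltaB_lauY_T (n : ℤ) : deltaB K (lauY K (T n)) =
    lauY K (T n) ⊗ₜ 1 + 1 ⊗ₜ lauY K (T n) -
      TensorProduct.map (lauY K) (lauY K) (mixedSum (lauLeft K) (lauRight K) n) := by
  rw [lauY_T, (deltaB_spec K).2, mixedSum, map_intSum]
  simp only [lauLeft, lauRight, Algebra.TensorProduct.tmul_mul_tmul, one_mul, mul_one,
    TensorProduct.map_tmul, lauY_T]

variable (N : ℕ)

/-- The element `(X₀^N - 1)^m X₀^a (X₁ - 1)` of `W^B`. -/
noncomputable def diffY (m : ℕ) (a : ℤ) : WB K := lauY K ((T N - 1) ^ m * T a)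

theorem coe_diffY (m : ℕ) (a : ℤ) :
    (diffY K N m a : VB K) = (bX K 0 N - 1) ^ m * bX K 0 a * (bX K 1 1 - 1) := by
  change evalX0 K ((T N - 1) ^ m * T a) * (bX K 1 1 - 1) = _
  rw [map_mul, map_pow, map_sub, map_one, evalX0_T, evalX0_T]

theorem diffY_succ (m : ℕ) (a : ℤ) : diffY K N (m + 1) a = diffY K N m (a + N) - diffY K N m a := by
  unfold diffY
  rw [← map_sub, T_add]
  congr 1
  ring

/-- Multiplying by X₀^N - 1 is taking a difference with step N in a; both sides obey this same
recursion in m. -/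
theorem deltaB_diffY_eq_mixedDiff (m : ℕ) (a : ℤ) : deltaB K (diffY K N m a) =
    diffY K N m a ⊗ₜ 1 + 1 ⊗ₜ diffY K N m a -
      TensorProduct.map (lauY K) (lauY K) (mixedDiff (lauLeft K) (lauRight K) N m a) := by
  induction m generalizing a with
  | zero =>
    rw [mixedDiff_zero, show diffY K N 0 a = lauY K (T a) by simp [diffY], deltaB_lauY_T]
  | succ m ih =>
    rw [mixedDiff_succ (lauLeft_add K) (lauRight_add K) (lauRight_zero K), diffY_succ, map_sub,
      map_sub, ih, ih, TensorProduct.sub_tmul, TensorProduct.tmul_sub]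
    abel

theorem map_lauY_mixedDiff (m : ℕ) (a : ℤ) :
    TensorProduct.map (lauY K) (lauY K) (mixedDiff (lauLeft K) (lauRight K) N m a) =
      TensorProduct.map (lauY K) (lauY K)
          ((1 ⊗ₜ ((T N - 1) ^ m)) * mixedSum (lauLeft K) (lauRight K) a)
        + ∑ i ∈ Finset.range m, ∑ j ∈ Finset.range N,
          diffY K N i (a + j) ⊗ₜ[K] diffY K N (m - 1 - i) (N - j) := by
  have h1 : lauLeft K N - 1 = (T N - 1) ⊗ₜ 1 := by
    rw [TensorProduct.sub_tmul]; rfl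
  have h2 : lauRight K N - 1 = 1 ⊗ₜ (T N - 1) := by
    rw [TensorProduct.tmul_sub]; rfl
  rw [mixedDiff, h1, h2, map_add, Finset.mul_sum, map_sum, Algebra.TensorProduct.tmul_pow, one_pow]
  congr 1
  refine Finset.sum_congr rfl fun i _ => ?_
  rw [Finset.mul_sum, Finset.sum_mul, map_sum]
  refine Finset.sum_congr rfl fun j _ => ?_
  simp only [lauLeft, lauRight, Algebra.TensorProduct.tmul_mul_tmul, one_mul, mul_one,
    TensorProduct.map_tmul, Algebra.TensorProduct.tmul_pow, one_pow, diffY]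
  rw [T_add, mul_comm (T a * T j), mul_comm (T _) (_ ^ (m - 1 - i))]

/-- This form separates the orders: the primitive terms and the double sum lie in F^(m+1), while the
last term lies in F^(m+2), its left factors being in F^1 and its right factors in F^(m+1). -/
theorem deltaB_diffY (m : ℕ) (a : ℤ) : deltaB K (diffY K N m a) =
    diffY K N m a ⊗ₜ 1 + 1 ⊗ₜ diffY K N m a
      - ∑ i ∈ Finset.range m, ∑ j ∈ Finset.range N,
          diffY K N i (a + j) ⊗ₜ[K] diffY K N (m - 1 - i) (N - j)
      - TensorProduct.map (lauY K) (lauY K)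
          ((1 ⊗ₜ ((T N - 1) ^ m)) * mixedSum (lauLeft K) (lauRight K) a) := by
  rw [deltaB_diffY_eq_mixedDiff, map_lauY_mixedDiff]
  abel

variable {K N} in
theorem commute_bX_zero (a : ℤ) (n : ℕ) : Commute (bX K 0 a) ((bX K 0 N - 1) ^ n) := by
  refine Commute.pow_right (Commute.sub_right ?_ (Commute.one_right _)) n
  change bX K 0 a * bX K 0 N = bX K 0 N * bX K 0 a
  rw [← bX_add, ← bX_add, add_comm]

variable [NeZero N]

theorem bX_pow_mem (m : ℕ) : (bX K 0 N - 1) ^ m ∈ (filtVB K N).F m := by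
  induction m with
  | zero => exact filtVB_zero K N _
  | succ m ih =>
    rw [pow_succ, Nat.cast_succ]
    exact (filtVB K N).mul_mem ih (mem_filtVB_one K N (bX_zero_N_sub_one_mem K N))

theorem lauY_mem (m : ℕ) (p : LaurentPolynomial K) :
    lauY K ((T N - 1) ^ m * p) ∈ (filtWB K N).F (m + 1) := by
  rw [mem_filtWB]
  change evalX0 K ((T N - 1) ^ m * p) * (bX K 1 1 - 1) ∈ _
  rw [map_mul, map_pow, map_sub, map_one, evalX0_T]
  have h := (filtVB K N).mul_mem (bX_pow_mem K N m) (filtVB_zero K N (evalX0 K p))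
  rw [add_zero] at h
  exact (filtVB K N).mul_mem h (mem_filtVB_one K N (bX_one_one_sub_one_mem K N))

theorem diffY_mem (m : ℕ) (a : ℤ) : diffY K N m a ∈ (filtWB K N).F (m + 1) := lauY_mem K N m _

theorem map_lauY_mem (m : ℕ) (z : LaurentPolynomial K ⊗[K] LaurentPolynomial K) :
    TensorProduct.map (lauY K) (lauY K) ((1 ⊗ₜ ((T N - 1) ^ m)) * z) ∈
      ((filtWB K N).tensor (filtWB K N)).F (m + 1 + 1) := by
  induction z using TensorProduct.induction_on with
  | zero => rw [mul_zero, map_zero]; exact Submodule.zero_mem _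
  | add z z' hz hz' => rw [mul_add, map_add]; exact Submodule.add_mem _ hz hz'
  | tmul p q =>
    rw [Algebra.TensorProduct.tmul_mul_tmul, one_mul, TensorProduct.map_tmul]
    have hp : lauY K p ∈ (filtWB K N).F 1 := by
      simpa using lauY_mem K N 0 p
    exact AlgFiltration.tmul_mem_tensor (by ring) hp (lauY_mem K N m q)

theorem tmul_diffY_mem {i j m : ℕ} (h : i + j + 1 = m) (a b : ℤ) :
    diffY K N i a ⊗ₜ[K] diffY K N j b ∈ ((filtWB K N).tensor (filtWB K N)).F (m + 1) :=
  AlgFiltration.tmul_mem_tensor (by rw [← h]; push_cast; ring) (diffY_mem K N i a)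
    (diffY_mem K N j b)

theorem deltaB_diffY_mem (m : ℕ) (a : ℤ) :
    deltaB K (diffY K N m a) ∈ ((filtWB K N).tensor (filtWB K N)).F (m + 1) := by
  rw [deltaB_diffY]
  refine Submodule.sub_mem _ (Submodule.sub_mem _ (Submodule.add_mem _ ?_ ?_) ?_) ?_
  · exact AlgFiltration.tmul_mem_tensor (add_zero _) (diffY_mem K N m a) (filtWB K N).one_mem
  · exact AlgFiltration.tmul_mem_tensor (zero_add _) (filtWB K N).one_mem (diffY_mem K N m a)
  · refine Submodule.sum_mem _ fun i hi => Submodule.sum_mem _ fun j _ => tmul_diffY_mem K N ?_ _ _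
    rw [Finset.mem_range] at hi
    omega
  · exact AlgFiltration.anti _ (by omega) (map_lauY_mem K N m _)

end BettiCoproduct

/-! ### The Betti coproduct is filtered -/

section DeltaFiltered

variable (K : Type*) [CommRing K] (N : ℕ) [NeZero N]

theorem tensor_filtWB_of_nonpos {m : ℤ} (hm : m ≤ 0) (z : WB K ⊗[K] WB K) :
    z ∈ ((filtWB K N).tensor (filtWB K N)).F m := by
  refine AlgFiltration.anti _ hm ?_
  induction z using TensorProduct.induction_on with
  | zero => exact Submodule.zero_mem _
  | add z z' hz hz' => exact Submodule.add_mem _ hz hz'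
  | tmul a b =>
    exact AlgFiltration.tmul_mem_tensor (add_zero 0)
      ((mem_filtWB K N).2 (filtVB_zero K N (a : VB K)))
      ((mem_filtWB K N).2 (filtVB_zero K N (b : VB K)))

/-- The elements `w ∈ W^B ⊂ K F₂` such that `Δ^{W,B}(w) ∈ F^m`. -/
noncomputable def deltaFil (m : ℤ) : Submodule K (VB K) :=
  (Submodule.comap (deltaB K).toLinearMap (((filtWB K N).tensor (filtWB K N)).F m)).map
    (WB K).val.toLinearMap

variable {K N}

theorem coe_mem_deltaFil {m : ℤ} {w : WB K}
    (h : deltaB K w ∈ ((filtWB K N).tensor (filtWB K N)).F m) : (w : VB K) ∈ deltaFil K N m :=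
  ⟨w, h, rfl⟩

theorem deltaB_mem_of_coe_mem {m : ℤ} {w : WB K} (h : (w : VB K) ∈ deltaFil K N m) :
    deltaB K w ∈ ((filtWB K N).tensor (filtWB K N)).F m := by
  obtain ⟨w', hw', h⟩ := h
  obtain rfl : w' = w := Subtype.ext h
  exact hw'

theorem deltaFil_mul {i j : ℤ} {a b : VB K} (ha : a ∈ deltaFil K N i) (hb : b ∈ deltaFil K N j) :
    a * b ∈ deltaFil K N (i + j) := by
  obtain ⟨a, ha, rfl⟩ := ha
  obtain ⟨b, hb, rfl⟩ := hb
  refine ⟨a * b, ?_, rfl⟩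
  change deltaB K (a * b) ∈ ((filtWB K N).tensor (filtWB K N)).F (i + j)
  rw [map_mul]
  exact AlgFiltration.mul_mem _ ha hb

theorem deltaFil_anti {i j : ℤ} (h : i ≤ j) : deltaFil K N j ≤ deltaFil K N i :=
  Submodule.map_mono (Submodule.comap_mono (AlgFiltration.anti _ h))

theorem diffY_mem_deltaFil (n : ℕ) (a : ℤ) :
    (bX K 0 N - 1) ^ n * bX K 0 a * (bX K 1 1 - 1) ∈ deltaFil K N (n + 1) := by
  rw [← coe_diffY]
  exact coe_mem_deltaFil (deltaB_diffY_mem K N n a)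

variable (K N)

/-- The span of the elements `(X₀^N - 1)^n X₀^a (X₁ - 1) w` with `Δ^{W,B}(w) ∈ F^(m-n-1)`. -/
noncomputable def deltaIdeal (m : ℤ) : Submodule K (VB K) :=
  Submodule.span K {u | ∃ (n : ℕ) (a : ℤ) (w : VB K), w ∈ deltaFil K N (m - n - 1) ∧
    u = (bX K 0 N - 1) ^ n * bX K 0 a * (bX K 1 1 - 1) * w}

variable {K N}

/-- Δ^{W,B} is multiplicative, and the orders n + 1 and m - n - 1 of the two factors add up to m. -/
theorem deltaIdeal_le (m : ℤ) : deltaIdeal K N m ≤ deltaFil K N m := by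
  refine Submodule.span_le.2 ?_
  rintro _ ⟨n, a, w, hw, rfl⟩
  have h := deltaFil_mul (diffY_mem_deltaFil n a) hw
  rwa [show (n : ℤ) + 1 + (m - n - 1) = m by ring] at h

theorem mul_mem_deltaIdeal {m m' : ℤ} {v u : VB K} (hu : u ∈ deltaIdeal K N m)
    (h : ∀ (n : ℕ) (a : ℤ) (w : VB K), w ∈ deltaFil K N (m - n - 1) →
      v * ((bX K 0 N - 1) ^ n * bX K 0 a * (bX K 1 1 - 1) * w) ∈ deltaIdeal K N m') :
    v * u ∈ deltaIdeal K N m' := by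
  suffices hle : deltaIdeal K N m ≤ (deltaIdeal K N m').comap (LinearMap.mulLeft K v) from hle hu
  refine Submodule.span_le.2 ?_
  rintro _ ⟨n, a, w, hw, rfl⟩
  exact h n a w hw

theorem sub_one_mul_mem_deltaIdeal {m : ℤ} {w : VB K} (hw : w ∈ deltaFil K N m) :
    (bX K 1 1 - 1) * w ∈ deltaIdeal K N (m + 1) :=
  Submodule.subset_span ⟨0, 0, w, by simpa using hw, by simp [bX_zero]⟩

theorem deltaIdeal_succ_le (m : ℤ) : deltaIdeal K N (m + 1) ≤ deltaIdeal K N m := by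
  refine Submodule.span_mono ?_
  rintro _ ⟨n, a, w, hw, rfl⟩
  exact ⟨n, a, w, deltaFil_anti (by omega) hw, rfl⟩

theorem bX_zero_mul_mem_deltaIdeal {m : ℤ} (b : ℤ) : bX K 0 b ∈ leftStab (deltaIdeal K N m) := by
  intro u hu
  refine mul_mem_deltaIdeal hu fun n a w hw => Submodule.subset_span ⟨n, b + a, w, hw, ?_⟩
  rw [bX_add, ← mul_assoc _ (bX K 0 b), ← (commute_bX_zero b n).eq]
  simp only [mul_assoc]

/-- Write X₁u = u + (X₁ - 1)u. Since u also lies in `deltaFil`, the second summand is of the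
generating form with n = a = 0, one step deeper than needed. -/
theorem bX_one_mul_mem_deltaIdeal {m : ℤ} : bX K 1 1 ∈ leftStab (deltaIdeal K N m) := by
  intro u hu
  have h := Submodule.add_mem _ hu
    (deltaIdeal_succ_le _ (sub_one_mul_mem_deltaIdeal (deltaIdeal_le m hu)))
  rwa [sub_mul, one_mul, add_sub_cancel] at h

/-- Write X₁⁻¹u = u - (X₁ - 1)X₁⁻¹u, where X₁⁻¹u lies in `deltaFil` because X₁⁻¹ belongs to W^B. -/
theorem bX_one_neg_mul_mem_deltaIdeal {m : ℤ} : bX K 1 (-1) ∈ leftStab (deltaIdeal K N m) := by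
  intro u hu
  have hX : bX K 1 (-1) ∈ deltaFil K N 0 :=
    coe_mem_deltaFil (w := wX1inv K) (tensor_filtWB_of_nonpos K N le_rfl _)
  have h1 := deltaFil_mul hX (deltaIdeal_le m hu)
  rw [zero_add] at h1
  have h := Submodule.sub_mem _ hu (deltaIdeal_succ_le _ (sub_one_mul_mem_deltaIdeal h1))
  rwa [sub_mul, one_mul, ← mul_assoc, ← bX_add, add_neg_cancel, bX_zero, one_mul,
    sub_sub_cancel] at h

theorem VB_mem_of_gen (E : Subalgebra K (VB K)) (h : ∀ i, bX K i 1 ∈ E)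
    (h' : ∀ i, bX K i (-1) ∈ E) (v : VB K) : v ∈ E := by
  induction v using MonoidAlgebra.induction_on with
  | of g =>
    induction g using FreeGroup.induction_on with
    | C1 => rw [map_one]; exact E.one_mem
    | of i => simpa [bX] using h i
    | inv_of i _ => simpa [bX] using h' i
    | mul a b ha hb => rw [map_mul]; exact E.mul_mem ha hb
  | add a b ha hb => exact E.add_mem ha hb
  | smul c a ha => exact E.smul_mem ha c

theorem mem_leftStab_deltaIdeal (m : ℤ) (v : VB K) : v ∈ leftStab (deltaIdeal K N m) := by
  refine VB_mem_of_gen _ (fun i => ?_) (fun i => ?_) v <;> fin_cases i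
  · exact bX_zero_mul_mem_deltaIdeal 1
  · exact bX_one_mul_mem_deltaIdeal
  · exact bX_zero_mul_mem_deltaIdeal (-1)
  · exact bX_one_neg_mul_mem_deltaIdeal

/-- With I_N inside V · S · V, both factors V are absorbed by stability under left multiplication.
On a spanning element, X₀^N - 1 raises n by one with w unchanged; X₁ - 1 takes the whole element as
a new w. -/
theorem idealI_mul_deltaIdeal_le (m : ℤ) :
    idealI K N * deltaIdeal K N m ≤ deltaIdeal K N (m + 1) := by
  have hS : Submodule.span K {bX K 0 N - 1, bX K 1 1 - 1} * deltaIdeal K N m ≤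
      deltaIdeal K N (m + 1) := by
    rw [← Submodule.span_eq (deltaIdeal K N m), Submodule.span_mul_span, Submodule.span_le]
    rintro _ ⟨_, rfl | rfl, u, hu, rfl⟩
    · refine mul_mem_deltaIdeal (v := bX K 0 N - 1) hu fun n a w hw =>
        Submodule.subset_span ⟨n + 1, a, w, ?_, ?_⟩
      · rwa [show m + 1 - (n + 1 : ℕ) - 1 = m - n - 1 by push_cast; ring]
      · rw [pow_succ']
        simp only [mul_assoc]
    · exact sub_one_mul_mem_deltaIdeal (deltaIdeal_le m hu)
  have hT : ∀ m, ⊤ * deltaIdeal K N m ≤ deltaIdeal K N m := fun m =>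
    Submodule.mul_le.2 fun v _ u hu => mem_leftStab_deltaIdeal m v u hu
  calc idealI K N * deltaIdeal K N m ≤ idealJ K N * deltaIdeal K N m :=
        mul_le_mul' idealI_le_idealJ le_rfl
    _ = ⊤ * (Submodule.span K {bX K 0 N - 1, bX K 1 1 - 1} * (⊤ * deltaIdeal K N m)) := by
      rw [idealJ]
      simp only [mul_assoc]
    _ ≤ ⊤ * (Submodule.span K {bX K 0 N - 1, bX K 1 1 - 1} * deltaIdeal K N m) :=
      mul_le_mul' le_rfl (mul_le_mul' le_rfl (hT m))
    _ ≤ ⊤ * deltaIdeal K N (m + 1) := mul_le_mul' le_rfl hS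
    _ ≤ deltaIdeal K N (m + 1) := hT _

theorem idealI_pow_mul_deltaIdeal_le (k : ℕ) (m : ℤ) :
    idealI K N ^ k * deltaIdeal K N m ≤ deltaIdeal K N (m + k) := by
  induction k with
  | zero => simp
  | succ k ih =>
    rw [pow_succ', mul_assoc]
    refine (mul_le_mul' le_rfl ih).trans ((idealI_mul_deltaIdeal_le _).trans_eq ?_)
    congr 1
    push_cast
    ring

variable (K N) [Algebra ℚ K]

/-- In positive degree i, F^i W^B is contained in F^(i-1)V^B · (X₁ - 1). As X₁ - 1 lies in
`deltaIdeal` of index 1, multiplying by I_N^(i-1) reaches index i. -/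
theorem isFiltered_deltaB :
    AlgFiltration.IsFiltered (filtWB K N) ((filtWB K N).tensor (filtWB K N)) (deltaB K) := by
  intro i w hw
  rcases le_or_gt i 0 with hi | hi
  · exact tensor_filtWB_of_nonpos K N hi _
  obtain ⟨v, hv, h⟩ := filtWB_eq_mul K N hi hw
  have hx : bX K 1 1 - 1 ∈ deltaIdeal K N 1 := by
    have h1 : (1 : VB K) ∈ deltaFil K N 0 :=
      coe_mem_deltaFil (w := 1) (tensor_filtWB_of_nonpos K N le_rfl _)
    simpa using sub_one_mul_mem_deltaIdeal h1
  apply deltaB_mem_of_coe_mem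
  rw [h]
  apply deltaIdeal_le
  obtain ⟨k, rfl⟩ : ∃ k : ℕ, i = k + 1 := ⟨i.toNat - 1, by omega⟩
  rw [add_sub_cancel_right] at hv
  -- The case k = 0 is separate: F^0 V^B is all of K F₂, whereas I_N^0 as a power of submodules is
  -- only K · 1.
  cases k with
  | zero => exact mem_leftStab_deltaIdeal _ v _ hx
  | succ k =>
    rw [filtVB_natCast_succ] at hv
    have h2 := idealI_pow_mul_deltaIdeal_le (k + 1) 1 (Submodule.mul_mem_mul hv hx)
    rwa [add_comm] at h2

end DeltaFiltered

/-! ### Compatibility of the coproducts -/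

section Compatibility

variable (K : Type*) [CommRing K] (N : ℕ) [NeZero N]

theorem rhoV_e0_pow (m : ℕ) : rhoV K N (drι K N .e0 ^ m) =
    (filtVB K N).cls m ((bX K 0 N - 1) ^ m) (bX_pow_mem K N m) := by
  induction m with
  | zero =>
    rw [pow_zero, map_one, ← AlgFiltration.cls_one]
    exact AlgFiltration.cls_congr _ Nat.cast_zero.symm (pow_zero _).symm _ _
  | succ m ih =>
    rw [pow_succ, map_mul, ih, rhoV_e0, AlgFiltration.cls_mul]
    exact AlgFiltration.cls_congr _ (Nat.cast_succ m).symm (pow_succ _ _).symm _ _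

theorem rhoW_drZ (m : ℕ) (a : ℤ) : rhoW K N (drZ K N (m + 1) (zetaN N ^ a)) =
    -(filtWB K N).cls (m + 1) (diffY K N m a) (diffY_mem K N m a) := by
  apply grIncl_injective K N
  rw [grIncl_rhoW, map_neg, grIncl_cls]
  change rhoV K N (-(drι K N .e0 ^ m * drι K N (.root (zetaN N ^ a))) * drι K N .e1) = _
  rw [neg_mul, map_neg, map_mul, map_mul, rhoV_e0_pow, rhoV_root, rhoV_e1, AlgFiltration.cls_mul,
    AlgFiltration.cls_mul]
  refine congrArg Neg.neg ?_
  exact AlgFiltration.cls_congr _ (by ring) (coe_diffY K N m a).symm _ _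

/-- Any N consecutive exponents run once through μ_N. Starting at a matches the shifts a + j in
`deltaB_diffY`. -/
theorem sum_rootsOfUnity_eq_sum_range {M : Type*} [AddCommMonoid M] (f : rootsOfUnity N ℂ → M)
    (a : ℤ) : ∑ η, f η = ∑ j ∈ Finset.range N, f (zetaN N ^ (a + j)) := by
  have hdvd : ∀ m n : ℤ, zetaN N ^ m = zetaN N ^ n ↔ (N : ℤ) ∣ m - n := by
    intro m n
    conv_rhs => rw [← zetaN_orderOf N]
    rw [orderOf_dvd_iff_zpow_eq_one, zpow_sub, mul_inv_eq_one]
  symm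
  refine Finset.sum_nbij (fun j => zetaN N ^ (a + (j : ℤ))) (fun _ _ => Finset.mem_univ _) ?_ ?_
    (fun _ _ => rfl)
  · intro i hi j hj h
    rw [Finset.mem_coe, Finset.mem_range] at hi hj
    obtain ⟨k, hk⟩ := (hdvd _ _).1 h
    have h1 : (i : ℤ) - j = N * k := by linarith
    have h2 := Int.eq_zero_of_abs_lt_dvd (Dvd.intro k h1.symm) (by rw [abs_lt]; omega)
    omega
  · intro η _
    obtain ⟨b, rfl⟩ := mem_zpowers_zetaN N η
    have hN : (N : ℤ) ≠ 0 := Nat.cast_ne_zero.2 (NeZero.ne N)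
    have h0 := Int.emod_nonneg (b - a) hN
    have h1 := Int.emod_lt_of_pos (b - a) (by omega : (0 : ℤ) < N)
    refine ⟨((b - a) % N).toNat, by rw [Finset.mem_coe, Finset.mem_range]; omega, ?_⟩
    refine (hdvd _ _).2 ?_
    rw [Int.toNat_of_nonneg h0]
    have := Int.emod_add_mul_ediv (b - a) N
    exact ⟨-((b - a) / N), by linarith⟩

theorem deltaDR_drZ (m : ℕ) (a : ℤ) : deltaDR K N (drZ K N (m + 1) (zetaN N ^ a)) =
    drZ K N (m + 1) (zetaN N ^ a) ⊗ₜ 1 + 1 ⊗ₜ drZ K N (m + 1) (zetaN N ^ a) +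
      ∑ i ∈ Finset.range m, ∑ j ∈ Finset.range N,
        drZ K N (i + 1) (zetaN N ^ (a + j)) ⊗ₜ[K]
          drZ K N (m - 1 - i + 1) (zetaN N ^ ((N : ℤ) - j)) := by
  have h : IsDeRhamCoproduct K N (deltaDR K N) :=
    (existsUnique_isDeRhamCoproduct K N).choose_spec.1
  rw [h (m + 1) (zetaN N ^ a) (by omega), Nat.add_sub_cancel]
  refine congrArg _ ?_
  refine Finset.sum_nbij' (· - 1) (· + 1) ?_ ?_ ?_ ?_ ?_
  · intro k hk
    rw [Finset.mem_Icc] at hk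
    rw [Finset.mem_range]
    omega
  · intro i hi
    rw [Finset.mem_range] at hi
    rw [Finset.mem_Icc]
    omega
  · intro k hk
    rw [Finset.mem_Icc] at hk
    omega
  · intro i _
    omega
  · intro k hk
    rw [Finset.mem_Icc] at hk
    rw [sum_rootsOfUnity_eq_sum_range N _ a]
    refine Finset.sum_congr rfl fun j _ => ?_
    -- For η = ζ_N^(a+j) the partner ζη⁻¹ is ζ_N^(-j); the representative N - j of the exponent is
    -- the one on the Betti side.
    have hζ : zetaN N ^ a * (zetaN N ^ (a + (j : ℤ)))⁻¹ = zetaN N ^ ((N : ℤ) - j) := by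
      rw [zpow_sub, zpow_natCast, zetaN_pow, one_mul, zpow_add, mul_inv_rev,
        mul_comm (_ ^ (j : ℤ))⁻¹, mul_inv_cancel_left]
    rw [hζ, show m + 1 - k = m - 1 - (k - 1) + 1 by omega, show k - 1 + 1 = k by omega]

/-- The remainder in `deltaB_diffY` has zero class, and the other terms match one by one. As
z_{m+1,ζ} corresponds to minus the class of `diffY`, linear terms change sign and quadratic ones do
not, which accounts for the opposite signs in the two coproducts. -/
theorem hasCls_deltaB_diffY (m : ℕ) (a : ℤ) :
    ((filtWB K N).tensor (filtWB K N)).HasCls (m + 1) (deltaB K (diffY K N m a))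
      (-AlgFiltration.grTensor (filtWB K N) (filtWB K N)
        (Algebra.TensorProduct.map (rhoW K N) (rhoW K N)
          (deltaDR K N (drZ K N (m + 1) (zetaN N ^ a))))) := by
  have hl := AlgFiltration.hasCls_tmul (add_zero _) (diffY_mem K N m a) (filtWB K N).one_mem
  have hr := AlgFiltration.hasCls_tmul (zero_add _) (filtWB K N).one_mem (diffY_mem K N m a)
  have hs : ((filtWB K N).tensor (filtWB K N)).HasCls (m + 1) _ _ :=
    AlgFiltration.HasCls.sum (s := Finset.range m) fun i hi =>
      AlgFiltration.HasCls.sum (s := Finset.range N) fun j _ =>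
        AlgFiltration.hasCls_tmul
          (by rw [Finset.mem_range] at hi; omega) (diffY_mem K N i (a + j))
          (diffY_mem K N (m - 1 - i) (N - j))
  have hz := AlgFiltration.hasCls_zero
    (map_lauY_mem K N m (mixedSum (lauLeft K) (lauRight K) a))
  have h := ((hl.add hr).sub hs).sub hz
  rw [← deltaB_diffY] at h
  convert h using 1
  rw [deltaDR_drZ]
  simp only [map_add, map_sum, Algebra.TensorProduct.map_tmul, rhoW_drZ, map_one,
    AlgFiltration.cls_one, TensorProduct.neg_tmul, TensorProduct.tmul_neg, neg_neg, map_neg]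
  abel

variable {K N}

theorem grTensor_grDeltaB
    (hΔ : AlgFiltration.IsFiltered (filtWB K N) ((filtWB K N).tensor (filtWB K N)) (deltaB K))
    (hcan : Function.Bijective (AlgFiltration.grTensor (filtWB K N) (filtWB K N)))
    (x : (filtWB K N).Gr) :
    AlgFiltration.grTensor (filtWB K N) (filtWB K N) (grDeltaB K N hΔ hcan x) =
      AlgFiltration.grMap (deltaB K) hΔ x :=
  (AlgEquiv.ofBijective (AlgFiltration.grTensor (filtWB K N) (filtWB K N)) hcan).apply_symm_apply _

theorem rhoW_comp_deltaDR
    (hΔ : AlgFiltration.IsFiltered (filtWB K N) ((filtWB K N).tensor (filtWB K N)) (deltaB K))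
    (hcan : Function.Bijective (AlgFiltration.grTensor (filtWB K N) (filtWB K N))) :
    (Algebra.TensorProduct.map (rhoW K N) (rhoW K N)).comp (deltaDR K N) =
      (grDeltaB K N hΔ hcan).comp (rhoW K N) := by
  -- Compare on the generators z_{n,ζ}, after applying the injective canonical map so that both
  -- sides become classes in gr(W^B ⊗ W^B).
  refine WDR_hom_ext (A := (filtWB K N).Gr ⊗[K] (filtWB K N).Gr) fun n ζ hn => hcan.1 ?_
  obtain ⟨m, rfl⟩ : ∃ m, n = m + 1 := ⟨n - 1, by omega⟩
  obtain ⟨a, rfl⟩ := mem_zpowers_zetaN N ζ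
  obtain ⟨h1, h2⟩ := hasCls_deltaB_diffY K N m a
  rw [AlgHom.comp_apply, AlgHom.comp_apply, grTensor_grDeltaB, rhoW_drZ, map_neg,
    AlgFiltration.grMap_cls, h2, neg_neg]

end Compatibility

theorem theorem1p6 (K : Type*) [CommRing K] [Algebra ℚ K] (N : ℕ) [NeZero N] :
    -- `ρ^W_N` is a graded isomorphism
    Function.Bijective (rhoW K N) ∧
    (∀ (n : ℕ) (w : WDR K N), (w : VDR K N) ∈ degVDR K N n →
      rhoW K N w ∈ LinearMap.range (DirectSum.lof K ℤ (filtWB K N).Piece n)) ∧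
    -- `gr(Δ^{W,B})` exists and the diagram commutes
    ∃ (hΔ : AlgFiltration.IsFiltered (filtWB K N) ((filtWB K N).tensor (filtWB K N)) (deltaB K))
      (hcan : Function.Bijective (AlgFiltration.grTensor (filtWB K N) (filtWB K N))),
      (Algebra.TensorProduct.map (rhoW K N) (rhoW K N)).comp (deltaDR K N) =
        (grDeltaB K N hΔ hcan).comp (rhoW K N) := by
  exact ⟨rhoW_bijective K N, fun n w hw => rhoW_mem_range_lof K N hw, isFiltered_deltaB K N,
    grTensor_filtWB_bijective K N, rhoW_comp_deltaDR _ _⟩
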